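/- All graphs are finite, simple and connected. For a graph $G$, let $n(G)$ be its number of vertices, $\omega(G)$ its clique number and $d_G$ its distance function. A set $W\subseteq V(G)$ is a local resolving set of $G$ if for any adjacent $u,v\in V(G)\setminus W$ there is $w\in W$ with $d_G(u,w)\neq d_G(v,w)$; the local metric dimension $\dim_l(G)$ is the smallest cardinality of a local resolving set. Let $\Gamma_1$ be the graph with vertices $v_1,\dots,v_6$ whose edges are all $v_iv_j$ with $1\le i<j\le 4$ together with $v_1v_5, v_1v_6, v_2v_5, v_3v_6$, and let $\Gamma_2$ be obtained from $\Gamma_1$ by adding the edge $v_5v_6$. A graph is $\{\Gamma_1,\Gamma_2\}$-free if it has no induced subgraph isomorphic to $\Gamma_1$ or to $\Gamma_2$. For $1\le\mu\le\lambda$ and $\lambda+\mu<n$, let $K_n^-(\lambda,\mu)$ be the graph obtained from the complete graph $K_n$ by removing the edges of a complete bipartite subgraph $K_{\lambda,\mu}$. Let $C_5$ be the cycle on five vertices. **Theorem.** Let $G$ be a finite simple connected graph with $n(G)\ge 5$. Then $\dim_l(G)=n(G)-3$ if and only if at least one of the following holds: 1. $\omega(G)=n(G)-2$ and $G$ is $\{\Gamma_1,\Gamma_2\}$-free;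 2. $G\cong C_5$; 3. $G\cong K_{n(G)}^-(\lambda,\mu)$ for some integers $\lambda\ge\mu\ge 2$ with $\lambda+\mu<n(G)$. -/

import Mathlib

/-- A set `W` of vertices is a local resolving set of `G` if any two adjacent vertices outside `W`
have different distances to some vertex of `W`. -/
def IsLocalResolvingSet {V : Type*} (G : SimpleGraph V) (W : Finset V) : Prop :=
  ∀ u v : V, u ∉ W → v ∉ W → G.Adj u v → ∃ w ∈ W, G.dist u w ≠ G.dist v w

/-- The local metric dimension: the least cardinality of a local resolving set. (For a finite
vertex set the whole vertex set is a local resolving set, so the infimum is a minimum.) -/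
noncomputable def localMetricDim {V : Type*} (G : SimpleGraph V) : ℕ :=
  sInf {k : ℕ | ∃ W : Finset V, W.card = k ∧ IsLocalResolvingSet G W}

/-- The graph `Γ₁` on `v₁, …, v₆` (numbered here `0, …, 5`): a complete graph on `v₁, v₂, v₃, v₄`
together with the edges `v₁v₅, v₁v₆, v₂v₅, v₃v₆`. -/
def Gamma1 : SimpleGraph (Fin 6) :=
  SimpleGraph.fromEdgeSet
    {s(0, 1), s(0, 2), s(0, 3), s(1, 2), s(1, 3), s(2, 3), s(0, 4), s(0, 5), s(1, 4), s(2, 5)}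

/-- The graph `Γ₂`, obtained from `Γ₁` by adding the edge `v₅v₆`. -/
def Gamma2 : SimpleGraph (Fin 6) :=
  Gamma1 ⊔ SimpleGraph.edge 4 5

/-- The graph `K_n⁻(l, m)`: the complete graph on `Fin n` with all edges removed between the first
`l` vertices and the next `m` vertices (it is used for `l + m < n` only). -/
def completeMinusBiclique (n l m : ℕ) : SimpleGraph (Fin n) where
  Adj i j := i ≠ j ∧
    ¬ (i.val < l ∧ l ≤ j.val ∧ j.val < l + m) ∧
    ¬ (j.val < l ∧ l ≤ i.val ∧ i.val < l + m)
  symm := ⟨fun _ _ h => ⟨h.1.symm, h.2.2, h.2.1⟩⟩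
  loopless := ⟨fun _ h => h.1 rfl⟩

/-! Subsets of a set whose complement resolves have the same property. So the dimension is n - 3
exactly when some three-set and no four-set has a resolving complement. Most of the work takes place
in the complement graph H of G, where two vertices of S are settled by an H-edge between them or by
an outside vertex H-adjacent to just one of them (`Spread`).

The clique number decides the case. If ω ≥ n - 1, no three-set works, since one outside vertex shows
at most two distances on a clique. If ω = n - 2, a good four-set lies inside a maximum clique and
must realise all four traces on the two remaining vertices, which is an induced Γ₁ or Γ₂.

If ω < n - 2, then H has no vertex cover of size two. Absence of good four-sets makes H
triangle-free (`NoSpreadFour.noTriangle`) and free of induced pairs of disjoint edges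
(`NoSpreadFour.noTwoEdges`). A pentagon in H must be all of H, and G is C₅. Otherwise H is a
bipartite chain graph with a dominating edge xy, plus isolated vertices.
`IsDominatingPair.adj_of_adj_of_adj` makes it complete bipartite, and connectedness of G supplies an
isolated vertex of H, so G is some K_n⁻(λ, μ).

Conversely, a good three-set exists whenever no single vertex covers H
(`exists_complResolves_card_three`), and each family excludes four-sets by twins or by a direct
distance count. -/

/-! ### Passing to complements of resolving sets -/

/-- The complement of `S` is a local resolving set, phrased through `S` alone. -/
def ComplResolves {V : Type*} (G : SimpleGraph V) (S : Finset V) : Prop :=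
  ∀ u ∈ S, ∀ v ∈ S, G.Adj u v → ∃ w, w ∉ S ∧ G.dist u w ≠ G.dist v w

theorem complResolves_iff {V : Type*} [Fintype V] [DecidableEq V] (G : SimpleGraph V)
    (S : Finset V) : ComplResolves G S ↔ IsLocalResolvingSet G Sᶜ := by
  simp only [ComplResolves, IsLocalResolvingSet, Finset.mem_compl, not_not]
  exact ⟨fun h u v hu hv => h u hu v hv, fun h u hu v hv => h u v hu hv⟩

theorem ComplResolves.mono {V : Type*} {G : SimpleGraph V} {S T : Finset V} (h : T ⊆ S)
    (hS : ComplResolves G S) : ComplResolves G T := by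
  intro u hu v hv huv
  obtain ⟨w, hw, hd⟩ := hS u (h hu) v (h hv) huv
  exact ⟨w, fun hw' => hw (h hw'), hd⟩

theorem localMetricDim_eq_card_sub_three_iff {V : Type*} [Fintype V] (G : SimpleGraph V)
    (hn : 4 ≤ Fintype.card V) :
    localMetricDim G = Fintype.card V - 3 ↔
      (∃ S : Finset V, S.card = 3 ∧ ComplResolves G S) ∧
        ∀ S : Finset V, S.card = 4 → ¬ ComplResolves G S := by
  classical
  have hne : {k : ℕ | ∃ W : Finset V, W.card = k ∧ IsLocalResolvingSet G W}.Nonempty :=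
    ⟨_, Finset.univ, rfl, fun u v hu => absurd (Finset.mem_univ u) hu⟩
  constructor
  · intro h
    constructor
    · obtain ⟨W, hW, hr⟩ := Nat.sInf_mem hne
      change W.card = localMetricDim G at hW
      refine ⟨Wᶜ, ?_, ?_⟩
      · rw [Finset.card_compl]; omega
      · rwa [complResolves_iff, compl_compl]
    · intro S hS hr
      rw [complResolves_iff] at hr
      have : localMetricDim G ≤ Fintype.card V - 4 :=
        Nat.sInf_le ⟨Sᶜ, by rw [Finset.card_compl, hS], hr⟩
      -- Here 4 ≤ n matters: for smaller n truncated subtraction gives n - 4 = n - 3.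
      omega
  · rintro ⟨⟨S, hS, hr⟩, hbad⟩
    rw [complResolves_iff] at hr
    refine le_antisymm (Nat.sInf_le ⟨Sᶜ, by rw [Finset.card_compl, hS], hr⟩) ?_
    refine le_csInf hne ?_
    rintro k ⟨W, rfl, hW⟩
    by_contra hlt
    have h4 : 4 ≤ (Wᶜ).card := by rw [Finset.card_compl]; omega
    obtain ⟨T, hT, hc⟩ := Finset.exists_subset_card_eq h4
    refine hbad T hc (ComplResolves.mono hT ?_)
    rwa [complResolves_iff, compl_compl]

/-! ### Twins, and resolution by adjacency -/

theorem SimpleGraph.Connected.exists_adj_mem_notMem {V : Type*} {G : SimpleGraph V}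
    (hG : G.Connected) (U : Set V) {a b : V} (ha : a ∈ U) (hb : b ∉ U) :
    ∃ u v, u ∈ U ∧ v ∉ U ∧ G.Adj u v := by
  obtain ⟨p⟩ := hG.preconnected a b
  obtain ⟨d, -, h1, h2⟩ := p.exists_boundary_dart U ha hb
  exact ⟨d.fst, d.snd, h1, h2, d.adj⟩

/-- Vertices with the same neighbours, apart from themselves, have the same distances. -/
theorem SimpleGraph.Connected.dist_eq_of_twins {V : Type*} {G : SimpleGraph V}
    (hG : G.Connected) {u v : V} (h : ∀ w, w ≠ u → w ≠ v → (G.Adj u w ↔ G.Adj v w))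
    {w : V} (hu : w ≠ u) (hv : w ≠ v) : G.dist u w = G.dist v w := by
  have key : ∀ {u v : V}, (∀ w, w ≠ u → w ≠ v → (G.Adj u w ↔ G.Adj v w)) →
      ∀ {w : V}, w ≠ u → w ≠ v → G.dist v w ≤ G.dist u w := by
    intro u v h w hu hv
    obtain ⟨p, hp⟩ := hG.exists_walk_length_eq_dist u w
    cases p with
    | nil => exact absurd rfl hu
    | @cons _ t _ hut q =>
      rw [SimpleGraph.Walk.length_cons] at hp
      rcases eq_or_ne t v with rfl | htv
      -- A shortest walk from u either passes through v at once, so its tail serves, or its first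
      -- step can be taken from v instead.
      · exact (SimpleGraph.dist_le q).trans (by omega)
      · have hvt : G.Adj v t := (h t hut.ne' htv).1 hut
        exact (SimpleGraph.dist_le (SimpleGraph.Walk.cons hvt q)).trans
          (by rw [SimpleGraph.Walk.length_cons]; omega)
  exact le_antisymm (key (fun w h1 h2 => (h w h2 h1).symm) hv hu) (key h hu hv)

theorem not_complResolves_of_twins {V : Type*} {G : SimpleGraph V} (hG : G.Connected)
    {S : Finset V} {u v : V} (hu : u ∈ S) (hv : v ∈ S) (huv : G.Adj u v)
    (h : ∀ w, w ≠ u → w ≠ v → (G.Adj u w ↔ G.Adj v w)) : ¬ ComplResolves G S := by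
  intro hS
  obtain ⟨w, hw, hd⟩ := hS u hu v hv huv
  exact hd (hG.dist_eq_of_twins h (fun e => hw (e ▸ hu)) (fun e => hw (e ▸ hv)))

/-- An edge is resolved as soon as some outside vertex is adjacent, in the complement, to just
one of its ends. -/
theorem dist_ne_of_compl_adj {V : Type*} {G : SimpleGraph V} {u v w : V} (hu : w ≠ u)
    (hv : w ≠ v) (h : ¬ (Gᶜ.Adj w u ↔ Gᶜ.Adj w v)) : G.dist u w ≠ G.dist v w := by
  intro hd
  apply h
  have h1 := SimpleGraph.dist_eq_one_iff_adj (G := G) (u := u) (v := w)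
  have h2 := SimpleGraph.dist_eq_one_iff_adj (G := G) (u := v) (v := w)
  rw [hd, h2] at h1
  simp only [SimpleGraph.compl_adj, G.adj_comm w]
  tauto

/-- Adjacency form of `ComplResolves`, in terms of the complement graph `H`. -/
def Spread {V : Type*} (H : SimpleGraph V) (S : Finset V) : Prop :=
  ∀ u ∈ S, ∀ v ∈ S, u ≠ v → H.Adj u v ∨ ∃ w, w ∉ S ∧ ¬ (H.Adj w u ↔ H.Adj w v)

theorem Spread.complResolves {V : Type*} {G : SimpleGraph V} {S : Finset V}
    (h : Spread Gᶜ S) : ComplResolves G S := by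
  intro u hu v hv huv
  rcases h u hu v hv huv.ne with h | ⟨w, hw, hd⟩
  · exact absurd huv ((SimpleGraph.compl_adj _ _ _).1 h).2
  · exact ⟨w, hw, dist_ne_of_compl_adj (fun e => hw (e ▸ hu)) (fun e => hw (e ▸ hv)) hd⟩

theorem exists_spread_card_three {V : Type*} (H : SimpleGraph V) (p q r : V)
    (h1 : p ≠ q) (h2 : p ≠ r) (h3 : q ≠ r)
    (hpq : H.Adj p q ∨ ∃ w, w ≠ p ∧ w ≠ q ∧ w ≠ r ∧ ¬ (H.Adj w p ↔ H.Adj w q))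
    (hpr : H.Adj p r ∨ ∃ w, w ≠ p ∧ w ≠ q ∧ w ≠ r ∧ ¬ (H.Adj w p ↔ H.Adj w r))
    (hqr : H.Adj q r ∨ ∃ w, w ≠ p ∧ w ≠ q ∧ w ≠ r ∧ ¬ (H.Adj w q ↔ H.Adj w r)) :
    ∃ S : Finset V, S.card = 3 ∧ Spread H S := by
  classical
  refine ⟨{p, q, r}, Finset.card_eq_three.2 ⟨p, q, r, h1, h2, h3, rfl⟩, ?_⟩
  intro u hu v hv huv
  simp only [Finset.mem_insert, Finset.mem_singleton, not_or] at hu hv ⊢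
  have hs := H.adj_comm u v
  grind

/-- The form in which four-sets are exhibited below: for each of the six pairs, an edge of H or an
outside vertex telling the pair apart. -/
theorem exists_spread_card_four {V : Type*} (H : SimpleGraph V) (p q r s : V)
    (h1 : p ≠ q) (h2 : p ≠ r) (h3 : p ≠ s) (h4 : q ≠ r) (h5 : q ≠ s) (h6 : r ≠ s)
    (hpq : H.Adj p q ∨ ∃ w, w ≠ p ∧ w ≠ q ∧ w ≠ r ∧ w ≠ s ∧ ¬ (H.Adj w p ↔ H.Adj w q))
    (hpr : H.Adj p r ∨ ∃ w, w ≠ p ∧ w ≠ q ∧ w ≠ r ∧ w ≠ s ∧ ¬ (H.Adj w p ↔ H.Adj w r))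
    (hps : H.Adj p s ∨ ∃ w, w ≠ p ∧ w ≠ q ∧ w ≠ r ∧ w ≠ s ∧ ¬ (H.Adj w p ↔ H.Adj w s))
    (hqr : H.Adj q r ∨ ∃ w, w ≠ p ∧ w ≠ q ∧ w ≠ r ∧ w ≠ s ∧ ¬ (H.Adj w q ↔ H.Adj w r))
    (hqs : H.Adj q s ∨ ∃ w, w ≠ p ∧ w ≠ q ∧ w ≠ r ∧ w ≠ s ∧ ¬ (H.Adj w q ↔ H.Adj w s))
    (hrs : H.Adj r s ∨ ∃ w, w ≠ p ∧ w ≠ q ∧ w ≠ r ∧ w ≠ s ∧ ¬ (H.Adj w r ↔ H.Adj w s)) :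
    ∃ S : Finset V, S.card = 4 ∧ Spread H S := by
  classical
  refine ⟨{p, q, r, s}, Finset.card_eq_four.2 ⟨p, q, r, s, h1, h2, h3, h4, h5, h6, rfl⟩, ?_⟩
  intro u hu v hv huv
  simp only [Finset.mem_insert, Finset.mem_singleton, not_or] at hu hv ⊢
  have hs := H.adj_comm u v
  grind

/-- If there is no clique missing at most the vertices of `X`, two nonadjacent vertices lie
outside `X`. -/
theorem exists_compl_adj_of_cliqueNum {V : Type*} [Fintype V] (G : SimpleGraph V) (X : Finset V)
    (h : G.cliqueNum + X.card < Fintype.card V) :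
    ∃ u v, u ∉ X ∧ v ∉ X ∧ Gᶜ.Adj u v := by
  classical
  by_contra hcon
  push Not at hcon
  have hc : G.IsClique (Xᶜ : Finset V) := by
    intro u hu v hv huv
    simp only [Finset.coe_compl, Set.mem_compl_iff, Finset.mem_coe] at hu hv
    have := hcon u v hu hv
    rw [SimpleGraph.compl_adj] at this
    tauto
  have := hc.card_le_cliqueNum
  rw [Finset.card_compl] at this
  omega

/-! ### Induced pairs of disjoint edges in the complement -/

/-- Every pair of vertices misses an edge of `H`, i.e. `H` has no vertex cover of size two. -/
def NoCoverTwo {V : Type*} (H : SimpleGraph V) : Prop :=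
  ∀ x y : V, ∃ u v, u ≠ x ∧ u ≠ y ∧ v ≠ x ∧ v ≠ y ∧ H.Adj u v

/-- `H` has no triangle. -/
def NoTriangle {V : Type*} (H : SimpleGraph V) : Prop :=
  ∀ a b c : V, H.Adj a b → H.Adj b c → ¬ H.Adj a c

/-- `H` has no induced pair of disjoint edges. -/
def NoTwoEdges {V : Type*} (H : SimpleGraph V) : Prop :=
  ∀ a b c d : V, H.Adj a b → H.Adj c d → a ≠ c → a ≠ d → b ≠ c → b ≠ d →
    H.Adj a c ∨ H.Adj a d ∨ H.Adj b c ∨ H.Adj b d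

/-- No four vertices are resolved by their complement through adjacency alone. -/
def NoSpreadFour {V : Type*} (H : SimpleGraph V) : Prop :=
  ∀ S : Finset V, S.card = 4 → ¬ Spread H S

/-- Handles the only way {a, b, c, d} can fail to be spread: two ends of different edges, say a and
c, agree on everything outside. The missing cover of size two then yields another spread four-set.
-/
theorem NoSpreadFour.twoEdges_aux {V : Type*} {H : SimpleGraph V} (hbad : NoSpreadFour H)
    (htri : NoTriangle H) (hcov : NoCoverTwo H) {a b c d : V} (hab : H.Adj a b)
    (hcd : H.Adj c d) (hac : a ≠ c) (had : a ≠ d) (hbc : b ≠ c) (hbd : b ≠ d)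
    (nac : ¬ H.Adj a c) (nad : ¬ H.Adj a d) (nbc : ¬ H.Adj b c) (nbd : ¬ H.Adj b d)
    (hsame : ∀ w, w ≠ a → w ≠ b → w ≠ c → w ≠ d → (H.Adj w a ↔ H.Adj w c)) : False := by
  have hs : ∀ u v, H.Adj u v → H.Adj v u := fun u v h => h.symm
  have hirr : ∀ u, ¬ H.Adj u u := fun u => H.irrefl
  have key : ∀ e, e ≠ a → e ≠ b → e ≠ c → e ≠ d → ¬ H.Adj e a := by
    intro e ea eb ec ed hea
    have hec : H.Adj e c := (hsame e ea eb ec ed).1 hea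
    -- One outside neighbour e of a forces all outside vertices to be neighbours of a. An edge
    -- avoiding a and c then closes a triangle with a or c.
    have hall : ∀ x, x ≠ a → x ≠ b → x ≠ c → x ≠ d → H.Adj x a := by
      intro x xa xb xc xd
      by_contra hxa
      have hxc : ¬ H.Adj x c := fun h => hxa ((hsame x xa xb xc xd).2 h)
      have hxe : x ≠ e := by rintro rfl; exact hxa hea
      obtain ⟨S, hS, hsp⟩ := exists_spread_card_four H b d e x hbd eb.symm xb.symm ed.symm
        xd.symm hxe.symm
        (.inr ⟨a, by grind⟩) (.inr ⟨c, by grind⟩) (.inr ⟨a, by grind⟩)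
        (.inr ⟨a, by grind⟩) (.inr ⟨c, by grind⟩) (.inr ⟨a, by grind⟩)
      exact hbad S hS hsp
    obtain ⟨u, v, h1, h2, h3, h4, huv⟩ := hcov a c
    have t1 := htri u v a huv
    have t2 := htri u v c huv
    by_cases u = b <;> by_cases u = d <;> by_cases v = b <;> by_cases v = d <;> grind
  obtain ⟨e, f, h1, h2, h3, h4, hef⟩ := hcov b d
  -- Now b and d are the only neighbours of a and c, so an edge ef avoiding b and d lies outside all
  -- four vertices. By triangle-freeness one of its ends is not adjacent to b.
  have main : ∀ e f, e ≠ b → e ≠ d → f ≠ b → f ≠ d → H.Adj e f → ¬ H.Adj f b → False := by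
    intro e f h1 h2 h3 h4 hef hfb
    have ea : e ≠ a := by intro h; have := key f; by_cases f = c <;> grind
    have fa : f ≠ a := by intro h; have := key e; by_cases e = c <;> grind
    have ec : e ≠ c := by intro h; have := key f; have := hsame f fa h3; by_cases f = c <;> grind
    have fc : f ≠ c := by intro h; have := key e; have := hsame e ea h1; by_cases e = c <;> grind
    have k1 := key f fa h3 fc h4
    have k2 : ¬ H.Adj f c := fun h => k1 ((hsame f fa h3 fc h4).2 h)
    have hne := hef.ne
    obtain ⟨S, hS, hsp⟩ := exists_spread_card_four H a c e b hac ea.symm hab.ne ec.symm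
      hbc.symm h1
      (.inr ⟨d, by grind⟩) (.inr ⟨f, by grind⟩) (.inl hab)
      (.inr ⟨f, by grind⟩) (.inr ⟨d, by grind⟩) (.inr ⟨f, by grind⟩)
    exact hbad S hS hsp
  by_cases hfb : H.Adj f b
  · exact main f e h3 h4 h1 h2 hef.symm (fun h => htri e f b hef hfb h)
  · exact main e f h1 h2 h3 h4 hef hfb

theorem NoSpreadFour.noTwoEdges {V : Type*} {H : SimpleGraph V} (hbad : NoSpreadFour H)
    (htri : NoTriangle H) (hcov : NoCoverTwo H) : NoTwoEdges H := by
  intro a b c d hab hcd hac had hbc hbd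
  by_contra hcon
  push Not at hcon
  obtain ⟨nac, nad, nbc, nbd⟩ := hcon
  have wit : ∀ u v, (¬ ∀ w, w ≠ a → w ≠ b → w ≠ c → w ≠ d → (H.Adj w u ↔ H.Adj w v)) →
      ∃ w, w ≠ a ∧ w ≠ b ∧ w ≠ c ∧ w ≠ d ∧ ¬ (H.Adj w u ↔ H.Adj w v) := by
    intro u v h
    push Not at h
    obtain ⟨w, h1, h2, h3, h4, h5⟩ := h
    exact ⟨w, h1, h2, h3, h4, by tauto⟩
  obtain ⟨S, hS, hsp⟩ := exists_spread_card_four H a b c d hab.ne hac had hbc hbd hcd.ne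
    (.inl hab)
    (.inr (wit a c fun h => hbad.twoEdges_aux htri hcov hab hcd hac had hbc hbd nac nad nbc nbd h))
    (.inr (wit a d fun h => hbad.twoEdges_aux htri hcov hab hcd.symm had hac hbd hbc nad nac nbd
      nbc fun w h1 h2 h3 h4 => h w h1 h2 h4 h3))
    (.inr (wit b c fun h => hbad.twoEdges_aux htri hcov hab.symm hcd hbc hbd hac had nbc nbd nac
      nad fun w h1 h2 h3 h4 => h w h2 h1 h3 h4))
    (.inr (wit b d fun h => hbad.twoEdges_aux htri hcov hab.symm hcd.symm hbd hbc had hac nbd nbc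
      nad nac fun w h1 h2 h3 h4 => h w h2 h1 h4 h3))
    (.inl hcd)
  exact hbad S hS hsp

/-! ### Pentagons in the complement -/

/-- Five vertices forming a cycle of `H`. -/
def IsPentagon {V : Type*} (H : SimpleGraph V) (a b c d e : V) : Prop :=
  H.Adj a b ∧ H.Adj b c ∧ H.Adj c d ∧ H.Adj d e ∧ H.Adj e a

theorem IsPentagon.rotate {V : Type*} {H : SimpleGraph V} {a b c d e : V}
    (h : IsPentagon H a b c d e) : IsPentagon H b c d e a :=
  ⟨h.2.1, h.2.2.1, h.2.2.2.1, h.2.2.2.2, h.1⟩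

theorem IsPentagon.reflect {V : Type*} {H : SimpleGraph V} {a b c d e : V}
    (h : IsPentagon H a b c d e) : IsPentagon H a e d c b :=
  ⟨h.2.2.2.2.symm, h.2.2.2.1.symm, h.2.2.1.symm, h.2.1.symm, h.1.symm⟩

theorem IsPentagon.induced {V : Type*} {H : SimpleGraph V} (htri : NoTriangle H)
    {a b c d e : V} (h : IsPentagon H a b c d e) :
    (¬ H.Adj a c ∧ ¬ H.Adj b d ∧ ¬ H.Adj c e ∧ ¬ H.Adj d a ∧ ¬ H.Adj e b) ∧
    (a ≠ b ∧ a ≠ c ∧ a ≠ d ∧ a ≠ e ∧ b ≠ c ∧ b ≠ d ∧ b ≠ e ∧ c ≠ d ∧ c ≠ e ∧ d ≠ e) := by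
  obtain ⟨h1, h2, h3, h4, h5⟩ := h
  have n1 := htri a b c h1 h2
  have n2 := htri b c d h2 h3
  have n3 := htri c d e h3 h4
  have n4 := htri d e a h4 h5
  have n5 := htri e a b h5 h1
  refine ⟨⟨n1, n2, n3, n4, n5⟩, h1.ne, ?_, ?_, h5.ne', h2.ne, ?_, ?_, h3.ne, ?_, h4.ne⟩
  · rintro rfl; exact n4 h3.symm
  · rintro rfl; exact n1 h3.symm
  · rintro rfl; exact n5 h4.symm
  · rintro rfl; exact n3 h2.symm
  · rintro rfl; exact n1 h5.symm

theorem IsPentagon.not_adj_adj {V : Type*} {H : SimpleGraph V} (hbad : NoSpreadFour H)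
    (htri : NoTriangle H) {a b c d e v : V} (h : IsPentagon H a b c d e)
    (hb : v ≠ b) (hva : H.Adj v a) (hvc : H.Adj v c) : False := by
  have hs : ∀ u v, H.Adj u v → H.Adj v u := fun u v h => h.symm
  obtain ⟨⟨n1, n2, n3, n4, n5⟩, d1, d2, d3, d4, d5, d6, d7, d8, d9, d10⟩ := h.induced htri
  obtain ⟨h1, h2, h3, h4, h5⟩ := h
  have hvd := htri v c d hvc h3
  have m1 : ¬ H.Adj v e := fun h => htri v e a h h5 hva
  have e1 := hva.ne
  have e2 := hvc.ne
  have e3 : v ≠ d := by rintro rfl; exact n4 hva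
  have e4 : v ≠ e := by rintro rfl; exact n3 hvc.symm
  obtain ⟨S, hS, hsp⟩ := exists_spread_card_four H a c d v d2 d3 e1.symm d8 e2.symm e3.symm
      (.inr ⟨e, by grind⟩) (.inr ⟨b, by grind⟩) (.inl hva.symm)
      (.inl h3) (.inl hvc.symm) (.inr ⟨e, by grind⟩)
  exact hbad S hS hsp

/-- The edges va and cd cannot be an induced pair, so v is also adjacent to c or d, hence to two
nonconsecutive vertices of the pentagon. -/
theorem IsPentagon.not_adj {V : Type*} {H : SimpleGraph V} (hbad : NoSpreadFour H)
    (htri : NoTriangle H) (h2k : NoTwoEdges H) {a b c d e v : V} (h : IsPentagon H a b c d e)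
    (hb : v ≠ b) (hc : v ≠ c) (hd : v ≠ d) (he : v ≠ e) : ¬ H.Adj v a := by
  intro hva
  obtain ⟨⟨n1, n2, n3, n4, n5⟩, d1, d2, d3, d4, d5, d6, d7, d8, d9, d10⟩ := h.induced htri
  rcases h2k v a c d hva h.2.2.1 hc hd d2 d3 with h' | h' | h' | h'
  · exact h.not_adj_adj hbad htri hb hva h'
  · exact h.reflect.not_adj_adj hbad htri he hva h'
  · exact n1 h'
  · exact n4 h'.symm

theorem IsPentagon.eq_of_noSpreadFour {V : Type*} {H : SimpleGraph V} (hbad : NoSpreadFour H)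
    (htri : NoTriangle H) (h2k : NoTwoEdges H) {a b c d e : V} (h : IsPentagon H a b c d e)
    (v : V) : v = a ∨ v = b ∨ v = c ∨ v = d ∨ v = e := by
  by_contra hcon
  push Not at hcon
  obtain ⟨e1, e2, e3, e4, e5⟩ := hcon
  have hs : ∀ u v, H.Adj u v → H.Adj v u := fun u v h => h.symm
  have m1 := h.not_adj hbad htri h2k e2 e3 e4 e5
  have m2 := h.rotate.not_adj hbad htri h2k e3 e4 e5 e1
  have m3 := h.rotate.rotate.not_adj hbad htri h2k e4 e5 e1 e2
  have m4 := h.rotate.rotate.rotate.not_adj hbad htri h2k e5 e1 e2 e3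
  have m5 := h.rotate.rotate.rotate.rotate.not_adj hbad htri h2k e1 e2 e3 e4
  obtain ⟨⟨n1, n2, n3, n4, n5⟩, d1, d2, d3, d4, d5, d6, d7, d8, d9, d10⟩ := h.induced htri
  obtain ⟨h1, h2, h3, h4, h5⟩ := h
  obtain ⟨S, hS, hsp⟩ := exists_spread_card_four H v a b d e1 e2 e4 d1 d3 d6
      (.inr ⟨e, by grind⟩) (.inr ⟨c, by grind⟩) (.inr ⟨c, by grind⟩)
      (.inl h1) (.inr ⟨c, by grind⟩) (.inr ⟨e, by grind⟩)
  exact hbad S hS hsp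

theorem IsPentagon.nonempty_iso_cycleGraph {V : Type*} {G : SimpleGraph V}
    (htri : NoTriangle Gᶜ) {a b c d e : V} (h : IsPentagon Gᶜ a b c d e)
    (hall : ∀ v, v = a ∨ v = b ∨ v = c ∨ v = d ∨ v = e) :
    Nonempty (G ≃g SimpleGraph.cycleGraph 5) := by
  obtain ⟨⟨n1, n2, n3, n4, n5⟩, d1, d2, d3, d4, d5, d6, d7, d8, d9, d10⟩ := h.induced htri
  obtain ⟨h1, h2, h3, h4, h5⟩ := h
  have hs : ∀ u v, G.Adj u v → G.Adj v u := fun u v h => h.symm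
  have hirr : ∀ u, ¬ G.Adj u u := fun u => G.irrefl
  simp only [SimpleGraph.compl_adj] at n1 n2 n3 n4 n5 h1 h2 h3 h4 h5
  -- The complement of a pentagon is the pentagon of its diagonals, traversed in this order.
  let f : Fin 5 → V := ![a, c, e, b, d]
  have hinj : Function.Injective f := by
    intro i j hij
    fin_cases i <;> fin_cases j <;> simp [f] at hij ⊢ <;> grind
  have hsurj : Function.Surjective f := by
    intro v
    rcases hall v with rfl | rfl | rfl | rfl | rfl
    · exact ⟨0, rfl⟩
    · exact ⟨3, rfl⟩
    · exact ⟨1, rfl⟩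
    · exact ⟨4, rfl⟩
    · exact ⟨2, rfl⟩
  let φ := Equiv.ofBijective f ⟨hinj, hsurj⟩
  have hφ : ∀ i j, G.Adj (f i) (f j) ↔ (SimpleGraph.cycleGraph 5).Adj i j := by
    intro i j
    fin_cases i <;> fin_cases j <;>
      simp [f, SimpleGraph.cycleGraph_adj] <;> grind
  exact ⟨(RelIso.symm ⟨φ, fun {i j} => hφ i j⟩)⟩

/-! ### Triangles in the complement -/

/-- A triangle T of H is an independent triple of G. Every other vertex x must be nearly a twin in G
of some `r x` in T, which makes G too rigid: connectedness forces two outside vertices to link the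
three members of T in a path, and such a path is impossible. -/
theorem NoSpreadFour.noTriangle {V : Type*} {G : SimpleGraph V} (hconn : G.Connected)
    (hbad : NoSpreadFour Gᶜ) (hcov : NoCoverTwo Gᶜ) : NoTriangle Gᶜ := by
  intro a b c hab hbc hac
  simp only [SimpleGraph.compl_adj] at hab hbc hac
  obtain ⟨hab, nab⟩ := hab
  obtain ⟨hbc, nbc⟩ := hbc
  obtain ⟨hac, nac⟩ := hac
  have hs : ∀ u v, G.Adj u v → G.Adj v u := fun u v h => h.symm
  have hirr : ∀ u, ¬ G.Adj u u := fun u => G.irrefl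
  let T : V → Prop := fun i => i = a ∨ i = b ∨ i = c
  have hT : ∀ i j, T i → T j → ¬ G.Adj i j := by
    rintro i j (rfl | rfl | rfl) (rfl | rfl | rfl) h <;> grind
  -- Otherwise T together with x is a spread four-set.
  have rep : ∀ x, ¬ T x → ∃ i, T i ∧ G.Adj x i ∧ ∀ w, ¬ T w → w ≠ x → (G.Adj x w ↔ G.Adj i w) := by
    intro x hx
    by_contra hcon
    push Not at hcon
    have hx' : x ≠ a ∧ x ≠ b ∧ x ≠ c := by simpa [T] using hx
    have wit : ∀ i, T i → Gᶜ.Adj i x ∨ ∃ w, w ≠ a ∧ w ≠ b ∧ w ≠ c ∧ w ≠ x ∧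
        ¬ (Gᶜ.Adj w i ↔ Gᶜ.Adj w x) := by
      intro i hi
      have hix : i ≠ x := by rintro rfl; exact hx hi
      by_cases h : G.Adj x i
      · right
        obtain ⟨w, hw, hwx, hd⟩ := hcon i hi h
        have hw' : w ≠ a ∧ w ≠ b ∧ w ≠ c := by simpa [T] using hw
        have hwi : w ≠ i := by rintro rfl; exact hw hi
        refine ⟨w, hw'.1, hw'.2.1, hw'.2.2, hwx, ?_⟩
        simp only [SimpleGraph.compl_adj, G.adj_comm w]
        tauto
      · left
        exact (SimpleGraph.compl_adj _ _ _).2 ⟨hix, fun h' => h h'.symm⟩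
    obtain ⟨S, hS, hsp⟩ := exists_spread_card_four Gᶜ a b c x hab hac hx'.1.symm hbc
      hx'.2.1.symm hx'.2.2.symm
      (.inl ((SimpleGraph.compl_adj _ _ _).2 ⟨hab, nab⟩))
      (.inl ((SimpleGraph.compl_adj _ _ _).2 ⟨hac, nac⟩)) (wit a (.inl rfl))
      (.inl ((SimpleGraph.compl_adj _ _ _).2 ⟨hbc, nbc⟩)) (wit b (.inr (.inl rfl)))
      (wit c (.inr (.inr rfl)))
    exact hbad S hS hsp
  choose! r hrT hrA hrN using rep
  have adj_iff : ∀ x y, ¬ T x → ¬ T y → x ≠ y → (G.Adj x y ↔ G.Adj y (r x)) := by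
    intro x y hx hy hxy
    rw [hrN x hx y hy hxy.symm, G.adj_comm]
  -- If i were G-adjacent to all outside vertices, an H-edge uv avoiding j and k would lie outside
  -- T, its representatives would be j and k, and {r u, u, v, r v} would be spread.
  have hub : ∀ i j k, T i → T j → T k → i ≠ j → i ≠ k → j ≠ k →
      (∀ x, ¬ T x → G.Adj x i) → False := by
    intro i j k hi hj hk hij hik hjk hall
    have hcover : ∀ t, T t → t = i ∨ t = j ∨ t = k := by
      rcases hi with rfl | rfl | rfl <;> rcases hj with rfl | rfl | rfl <;>
        rcases hk with rfl | rfl | rfl <;> rintro t (rfl | rfl | rfl) <;> grind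
    obtain ⟨u, v, h1, h2, h3, h4, huv⟩ := hcov j k
    obtain ⟨hne, nuv⟩ := (SimpleGraph.compl_adj _ _ _).1 huv
    have hu : ¬ T u := by
      intro hu
      have hui : u = i := by grind
      subst hui
      by_cases hv : T v
      · grind
      · exact nuv (hall v hv).symm
    have hv : ¬ T v := by
      intro hv
      have hvi : v = i := by grind
      subst hvi
      exact nuv (hall u hu)
    have a1 := adj_iff u v hu hv hne
    have a2 := adj_iff v u hv hu hne.symm
    have b1 := hrA u hu
    have b2 := hrA v hv
    have t1 := hrT u hu
    have t2 := hrT v hv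
    have c1 := hall u hu
    have c2 := hall v hv
    have d1 : r u ≠ i := by grind
    have d2 : r v ≠ i := by grind
    have d3 : r u ≠ r v := by grind
    have e1 : r u ≠ u := fun h => hu (h ▸ t1)
    have e2 : r u ≠ v := fun h => hv (h ▸ t1)
    have e3 : r v ≠ u := fun h => hu (h ▸ t2)
    have e4 : r v ≠ v := fun h => hv (h ▸ t2)
    have e5 : i ≠ u := fun h => hu (h ▸ hi)
    have e6 : i ≠ v := fun h => hv (h ▸ hi)
    have n1 := hT _ _ hi t1
    have n2 := hT _ _ hi t2
    have n3 := hT _ _ t1 t2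
    obtain ⟨S, hS, hsp⟩ := exists_spread_card_four Gᶜ (r u) u v (r v) e1 e2 d3 hne e3.symm
      e4.symm
      (.inr ⟨i, by simp only [SimpleGraph.compl_adj]; grind⟩)
      (.inl (by simp only [SimpleGraph.compl_adj]; grind))
      (.inl (by simp only [SimpleGraph.compl_adj]; grind))
      (.inl huv)
      (.inl (by simp only [SimpleGraph.compl_adj]; grind))
      (.inr ⟨i, by simp only [SimpleGraph.compl_adj]; grind⟩)
    exact hbad S hS hsp
  have Ta : T a := .inl rfl
  have Tb : T b := .inr (.inl rfl)
  have Tc : T c := .inr (.inr rfl)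
  -- A vertex x seeing all of T sees every outside y, because y is represented in T; then `r x` is a
  -- hub.
  have nofull : ∀ x, ¬ T x → ¬ (G.Adj x a ∧ G.Adj x b ∧ G.Adj x c) := by
    rintro x hx ⟨xa, xb, xc⟩
    have hxT : ∀ t, T t → G.Adj x t := by rintro t (rfl | rfl | rfl) <;> assumption
    have hall : ∀ y, ¬ T y → G.Adj y (r x) := by
      intro y hy
      rcases eq_or_ne x y with rfl | hxy
      · exact hrA x hx
      · rw [← adj_iff x y hx hy hxy, G.adj_comm, adj_iff y x hy hx hxy.symm]
        exact hxT _ (hrT y hy)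
    rcases hrT x hx with h | h | h
    · exact hub a b c Ta Tb Tc hab hac hbc (h ▸ hall)
    · exact hub b a c Tb Ta Tc hab.symm hbc hac (h ▸ hall)
    · exact hub c a b Tc Ta Tb hac.symm hbc.symm hab (h ▸ hall)
  have path : ∀ i j k x y, T i → T j → T k → i ≠ j → i ≠ k → j ≠ k → ¬ T x → ¬ T y →
      G.Adj x i → G.Adj x j → G.Adj y j → G.Adj y k → False := by
    intro i j k x y hi hj hk hij hik hjk hx hy xi xj yj yk
    have hcover : ∀ t, T t → t = i ∨ t = j ∨ t = k := by
      rcases hi with rfl | rfl | rfl <;> rcases hj with rfl | rfl | rfl <;>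
        rcases hk with rfl | rfl | rfl <;> rintro t (rfl | rfl | rfl) <;> grind
    have nofull' : ∀ x, ¬ T x → ¬ (G.Adj x i ∧ G.Adj x j ∧ G.Adj x k) := by
      rintro x hx ⟨x1, x2, x3⟩
      apply nofull x hx
      have : ∀ t, T t → G.Adj x t := by
        intro t ht
        rcases hcover t ht with rfl | rfl | rfl <;> assumption
      exact ⟨this a Ta, this b Tb, this c Tc⟩
    have nxk : ¬ G.Adj x k := fun h => nofull' x hx ⟨xi, xj, h⟩
    have nyi : ¬ G.Adj y i := fun h => nofull' y hy ⟨h, yj, yk⟩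
    have hxy : x ≠ y := by rintro rfl; exact nxk yk
    by_cases hadj : G.Adj x y
    -- If x and y are adjacent, both are represented by j. An outside z missing j would miss x and
    -- y, so its representative would miss them too, yet every member of T sees x or y. Hence j is a
    -- hub.
    · have rx : r x = j := by
        have := (adj_iff x y hx hy hxy).1 hadj
        have := hrA x hx
        have := hcover _ (hrT x hx)
        grind
      have ry : r y = j := by
        have := (adj_iff y x hy hx hxy.symm).1 hadj.symm
        have := hrA y hy
        have := hcover _ (hrT y hy)
        grind
      refine hub j i k hj hi hk hij.symm hjk hik ?_
      intro z hz
      by_contra hzj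
      have zx : z ≠ x := by rintro rfl; exact hzj xj
      have zy : z ≠ y := by rintro rfl; exact hzj yj
      have h1 := adj_iff x z hx hz zx.symm
      have h2 := adj_iff y z hy hz zy.symm
      have h3 := adj_iff z x hz hx zx
      have h4 := adj_iff z y hz hy zy
      have h5 := hrA z hz
      rw [rx] at h1
      rw [ry] at h2
      rcases hcover _ (hrT z hz) with h | h | h <;> rw [h] at h3 h4 h5 <;> grind
    · have q1 : i ≠ x := fun h => hx (h ▸ hi)
      have q2 : i ≠ y := fun h => hy (h ▸ hi)
      have q3 : j ≠ x := fun h => hx (h ▸ hj)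
      have q4 : j ≠ y := fun h => hy (h ▸ hj)
      have q5 : k ≠ x := fun h => hx (h ▸ hk)
      have q6 : k ≠ y := fun h => hy (h ▸ hk)
      have n1 := hT _ _ hi hj
      have n2 := hT _ _ hj hk
      have n3 := hT _ _ hi hk
      obtain ⟨S, hS, hsp⟩ := exists_spread_card_four Gᶜ i x y k q1 q2 hik hxy q5.symm q6.symm
        (.inr ⟨j, by simp only [SimpleGraph.compl_adj]; grind⟩)
        (.inl (by simp only [SimpleGraph.compl_adj]; grind))
        (.inl (by simp only [SimpleGraph.compl_adj]; grind))
        (.inl (by simp only [SimpleGraph.compl_adj]; grind))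
        (.inl (by simp only [SimpleGraph.compl_adj]; grind))
        (.inr ⟨j, by simp only [SimpleGraph.compl_adj]; grind⟩)
      exact hbad S hS hsp
  -- Without such an x, the vertex i and its outside neighbours would be a union of components of G
  -- missing j.
  have link : ∀ i j, T i → T j → i ≠ j → ∃ x k, ¬ T x ∧ T k ∧ k ≠ i ∧ G.Adj x i ∧ G.Adj x k := by
    intro i j hi hj hij
    by_contra hcon
    push Not at hcon
    obtain ⟨u, v, hu, hv, huv⟩ := hconn.exists_adj_mem_notMem
      {z | z = i ∨ (¬ T z ∧ G.Adj z i)} (a := i) (b := j) (.inl rfl)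
      (by rintro (h | ⟨h, -⟩); exacts [hij h.symm, h hj])
    have hvi : v ≠ i := fun h => hv (.inl h)
    rcases hu with rfl | ⟨hu, hui⟩
    · by_cases hvT : T v
      · exact hT _ _ hi hvT huv
      · exact hv (.inr ⟨hvT, huv.symm⟩)
    · by_cases hvT : T v
      · exact hcon u v hu hvT hvi hui huv
      · have hru : r u = i := by
          by_contra h
          exact hcon u (r u) hu (hrT u hu) h hui (hrA u hu)
        have := (adj_iff u v hu hvT huv.ne).1 huv
        rw [hru] at this
        exact hv (.inr ⟨hvT, this⟩)
  obtain ⟨x, k, hx, hk, hka, hxa, hxk⟩ := link a b Ta Tb hab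
  obtain ⟨m, hm, hma, hmk, hcover⟩ : ∃ m, T m ∧ m ≠ a ∧ m ≠ k ∧ ∀ t, T t → t = a ∨ t = k ∨ t = m := by
    rcases hk with rfl | rfl | rfl
    · exact absurd rfl hka
    · exact ⟨c, Tc, hac.symm, hbc.symm, fun t ht => ht⟩
    · exact ⟨b, Tb, hab.symm, hbc, fun t ht => by rcases ht with h | h | h <;> simp [h]⟩
  obtain ⟨y, l, hy, hl, hlm, hym, hyl⟩ := link m a hm Ta hma
  rcases hcover l hl with rfl | rfl | rfl
  · exact path k l m x y hk Ta hm hka hmk.symm hma.symm hx hy hxk hxa hyl hym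
  · exact path a l m x y Ta hk hm hka.symm hma.symm hmk.symm hx hy hxa hxk hyl hym
  · exact hlm rfl

/-! ### Chain structure of the complement -/

/-- A two-edge-free, triangle-free graph without pentagon is covered by the neighbourhood of a
vertex of largest degree. -/
theorem exists_neighborhood_cover {V : Type*} [Fintype V] [Nonempty V] {H : SimpleGraph V}
    (h2k : NoTwoEdges H) (hpent : ∀ a b c d e, ¬ IsPentagon H a b c d e) :
    ∃ x, ∀ p q, H.Adj p q → H.Adj x p ∨ H.Adj x q := by
  classical
  obtain ⟨x, -, hx⟩ := Finset.exists_max_image Finset.univ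
    (fun v => (Finset.univ.filter (H.Adj v)).card) Finset.univ_nonempty
  refine ⟨x, fun p q hpq => ?_⟩
  by_contra hcon
  push Not at hcon
  obtain ⟨hxp, hxq⟩ := hcon
  have main : ∀ p q, H.Adj p q → ¬ H.Adj x p → ¬ H.Adj x q → ∃ a, H.Adj x a ∧ ¬ H.Adj a p := by
    intro p q hpq hxp hxq
    by_contra hall
    push Not at hall
    -- All neighbours of x lie in N(p), as does q, which is not in N(x): p would have larger degree.
    have hlt : Finset.univ.filter (H.Adj x) ⊂ Finset.univ.filter (H.Adj p) := by
      refine Finset.ssubset_iff_subset_ne.2 ⟨fun a ha => ?_, fun h => ?_⟩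
      · simp only [Finset.mem_filter, Finset.mem_univ, true_and] at ha ⊢
        exact (hall a ha).symm
      · have : q ∈ Finset.univ.filter (H.Adj x) := by rw [h]; simpa using hpq
        simp only [Finset.mem_filter, Finset.mem_univ, true_and] at this
        exact hxq this
    exact absurd (hx p (Finset.mem_univ p)) (not_le.2 (Finset.card_lt_card hlt))
  have split : ∀ a, H.Adj x a → ¬ H.Adj a p → H.Adj a q := by
    intro a hxa hap
    have xp : x ≠ p := by rintro rfl; exact hxq hpq
    have xq : x ≠ q := by rintro rfl; exact hxp hpq.symm
    have ap : a ≠ p := by rintro rfl; exact hxp hxa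
    have aq : a ≠ q := by rintro rfl; exact hxq hxa
    rcases h2k x a p q hxa hpq xp xq ap aq with h | h | h | h
    · exact absurd h hxp
    · exact absurd h hxq
    · exact absurd h hap
    · exact h
  obtain ⟨a, hxa, hap⟩ := main p q hpq hxp hxq
  obtain ⟨b, hxb, hbq⟩ := main q p hpq.symm hxq hxp
  have haq := split a hxa hap
  have hbp : H.Adj b p := by
    by_contra h
    exact hbq (split b hxb h)
  exact hpent x a q p b ⟨hxa, haq, hpq.symm, hbp.symm, hxb.symm⟩

/-- In a two-edge-free graph the neighbourhoods of the vertices of an independent cover are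
nested. -/
theorem exists_dominating_pair {V : Type*} [Fintype V] {H : SimpleGraph V}
    (htri : NoTriangle H) (h2k : NoTwoEdges H) {x : V}
    (hx : ∀ p q, H.Adj p q → H.Adj x p ∨ H.Adj x q) {p q : V} (hpq : H.Adj p q) :
    ∃ y, H.Adj x y ∧ ∀ p q, H.Adj p q →
      (H.Adj x p ∧ H.Adj y q) ∨ (H.Adj y p ∧ H.Adj x q) := by
  classical
  have hne : (Finset.univ.filter (H.Adj x)).Nonempty := by
    rcases hx p q hpq with h | h
    · exact ⟨p, by simpa using h⟩
    · exact ⟨q, by simpa using h⟩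
  obtain ⟨y, hy, hmax⟩ := Finset.exists_max_image _
    (fun v => (Finset.univ.filter (H.Adj v)).card) hne
  simp only [Finset.mem_filter, Finset.mem_univ, true_and] at hy hmax
  have key : ∀ a b, H.Adj x a → H.Adj a b → H.Adj y b := by
    intro a b hxa hab
    by_contra hyb
    have : ∃ b', H.Adj y b' ∧ ¬ H.Adj a b' := by
      by_contra hall
      push Not at hall
      have hlt : Finset.univ.filter (H.Adj y) ⊂ Finset.univ.filter (H.Adj a) := by
        refine Finset.ssubset_iff_subset_ne.2 ⟨fun c hc => ?_, fun h => ?_⟩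
        · simp only [Finset.mem_filter, Finset.mem_univ, true_and] at hc ⊢
          exact hall c hc
        · have : b ∈ Finset.univ.filter (H.Adj y) := by rw [h]; simpa using hab
          simp only [Finset.mem_filter, Finset.mem_univ, true_and] at this
          exact hyb this
      exact absurd (hmax a hxa) (not_le.2 (Finset.card_lt_card hlt))
    obtain ⟨b', hyb', hab'⟩ := this
    have nya : ¬ H.Adj y a := fun h => htri x y a hy h hxa
    have nxb : ¬ H.Adj x b := htri x a b hxa hab
    have nxb' : ¬ H.Adj x b' := htri x y b' hy hyb'
    have nbb' : ¬ H.Adj b' b := fun h => (hx b' b h).elim nxb' nxb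
    -- If y misses b, maximality of its degree gives b' seen by y and not by a; then yb' and ab are
    -- an induced pair of edges.
    rcases h2k y b' a b hyb' hab (by rintro rfl; exact hyb hab) (by rintro rfl; exact nxb hy)
      (by rintro rfl; exact nxb' hxa) (by rintro rfl; exact hyb hyb') with h | h | h | h
    · exact nya h
    · exact hyb h
    · exact hab' h.symm
    · exact nbb' h
  refine ⟨y, hy, fun p q hpq => ?_⟩
  rcases hx p q hpq with h | h
  · exact .inl ⟨h, key p q h hpq⟩
  · exact .inr ⟨key q p h hpq.symm, h⟩

/-! ### Recognising K_n⁻(λ, μ) -/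

/-- Adjacency depends only on the class (A, B or the rest), so any bijection matching the fibres of
the two three-colourings is an isomorphism; such a bijection exists because the fibres have equal
sizes. -/
theorem nonempty_iso_completeMinusBiclique {V : Type*} [Fintype V] {G : SimpleGraph V}
    (A B : Finset V) (hAB : Disjoint A B)
    (hG : ∀ u v, G.Adj u v ↔ u ≠ v ∧ ¬ (u ∈ A ∧ v ∈ B) ∧ ¬ (v ∈ A ∧ u ∈ B)) :
    Nonempty (G ≃g completeMinusBiclique (Fintype.card V) A.card B.card) := by
  classical
  have hcard : A.card + B.card ≤ Fintype.card V := by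
    rw [← Finset.card_union_of_disjoint hAB]; exact Finset.card_le_univ _
  let f : V → Fin 3 := fun v => if v ∈ A then 0 else if v ∈ B then 1 else 2
  let g : Fin (Fintype.card V) → Fin 3 := fun i =>
    if i.val < A.card then 0 else if i.val < A.card + B.card then 1 else 2
  have hdisj : ∀ v, v ∈ A → v ∉ B := fun v h => Finset.disjoint_left.1 hAB h
  have f0 : Finset.univ.filter (fun v => f v = 0) = A := by
    ext v; simp only [f, Finset.mem_filter, Finset.mem_univ, true_and]; split_ifs <;> simp_all
  have f1 : Finset.univ.filter (fun v => f v = 1) = B := by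
    ext v; simp only [f, Finset.mem_filter, Finset.mem_univ, true_and]
    have := hdisj v
    split_ifs <;> simp_all
  have g0 : (Finset.univ.filter (fun v => g v = 0)).card = A.card := by
    have : (Finset.univ.filter (fun v => g v = 0)).map Fin.valEmbedding = Finset.range A.card := by
      ext k
      simp only [g, Finset.mem_map, Finset.mem_filter, Finset.mem_univ, true_and,
        Fin.valEmbedding_apply, Finset.mem_range]
      constructor
      · rintro ⟨i, hi, rfl⟩
        split_ifs at hi <;> simp_all
      · intro hk
        exact ⟨⟨k, by omega⟩, by simp [hk], rfl⟩
    rw [← Finset.card_map Fin.valEmbedding, this, Finset.card_range]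
  have g1 : (Finset.univ.filter (fun v => g v = 1)).card = B.card := by
    have : (Finset.univ.filter (fun v => g v = 1)).map Fin.valEmbedding =
        Finset.Ico A.card (A.card + B.card) := by
      ext k
      simp only [g, Finset.mem_map, Finset.mem_filter, Finset.mem_univ, true_and,
        Fin.valEmbedding_apply, Finset.mem_Ico]
      constructor
      · rintro ⟨i, hi, rfl⟩
        split_ifs at hi <;> simp_all
      · intro hk
        exact ⟨⟨k, by omega⟩, by simp [hk], rfl⟩
    rw [← Finset.card_map Fin.valEmbedding, this, Nat.card_Ico]; omega
  have hf : ∀ {α : Type _} [Fintype α] (h : α → Fin 3),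
      (Finset.univ.filter (fun v => h v = 0)).card + (Finset.univ.filter (fun v => h v = 1)).card +
      (Finset.univ.filter (fun v => h v = 2)).card = Fintype.card α := by
    intro α _ h
    have := Finset.card_eq_sum_card_fiberwise (f := h) (s := Finset.univ) (t := Finset.univ)
      (fun _ _ => Finset.mem_coe.2 (Finset.mem_univ _))
    rw [Fin.sum_univ_three, Finset.card_univ] at this
    exact this.symm
  have hg : (Finset.univ.filter (fun v => g v = 0)).card +
      (Finset.univ.filter (fun v => g v = 1)).card +
      (Finset.univ.filter (fun v => g v = 2)).card = Fintype.card V := by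
    have := Finset.card_eq_sum_card_fiberwise (f := g) (s := Finset.univ) (t := Finset.univ)
      (fun _ _ => Finset.mem_coe.2 (Finset.mem_univ _))
    rw [Fin.sum_univ_three, Finset.card_univ, Fintype.card_fin] at this
    exact this.symm
  have hff := hf f
  have hfib : ∀ c, Fintype.card {v // f v = c} = Fintype.card {i // g i = c} := by
    intro c
    rw [Fintype.card_subtype, Fintype.card_subtype]
    fin_cases c
    · exact (congrArg Finset.card f0).trans g0.symm
    · exact (congrArg Finset.card f1).trans g1.symm
    · have e0 := congrArg Finset.card f0
      have e1 := congrArg Finset.card f1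
      change (Finset.univ.filter (fun v => f v = 2)).card =
        (Finset.univ.filter (fun v => g v = 2)).card
      omega
  let e : V ≃ Fin (Fintype.card V) :=
    Equiv.ofFiberEquiv (f := f) (g := g) fun c => Fintype.equivOfCardEq (hfib c)
  have he : ∀ v, g (e v) = f v := fun v => Equiv.ofFiberEquiv_map _ v
  have hA : ∀ v, v ∈ A ↔ (e v).val < A.card := by
    intro v
    have := he v
    simp only [f, g] at this
    split_ifs at this <;> simp_all
  have hB : ∀ v, v ∈ B ↔ A.card ≤ (e v).val ∧ (e v).val < A.card + B.card := by
    intro v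
    have h1 := he v
    have h2 := hdisj v
    simp only [f, g] at h1
    split_ifs at h1 <;> simp_all
  refine ⟨⟨e, ?_⟩⟩
  intro u v
  change (e u ≠ e v ∧ _) ↔ _
  rw [hG, hA u, hA v, hB u, hB v, e.injective.ne_iff]

/-! ### From a chain graph to a complete bipartite graph -/

theorem SimpleGraph.Connected.three_le_dist {V : Type*} {G : SimpleGraph V} (hG : G.Connected)
    {u w : V} (hne : u ≠ w) (hadj : ¬ G.Adj u w) (hno : ∀ c, G.Adj u c → ¬ G.Adj c w) :
    3 ≤ G.dist u w := by
  obtain ⟨p, hp⟩ := hG.exists_walk_length_eq_dist u w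
  rw [← hp]
  rcases p with _ | ⟨h1, _ | ⟨h2, _ | ⟨h3, p⟩⟩⟩
  · exact absurd rfl hne
  · exact absurd h1 hadj
  · exact absurd h2 (hno _ h1)
  · simp only [SimpleGraph.Walk.length_cons]; omega

theorem SimpleGraph.dist_le_two {V : Type*} {G : SimpleGraph V} {u v w : V} (h1 : G.Adj u v)
    (h2 : G.Adj v w) : G.dist u w ≤ 2 :=
  SimpleGraph.dist_le (SimpleGraph.Walk.cons h1 (SimpleGraph.Walk.cons h2 .nil))

theorem exists_complResolves_card_four {V : Type*} (G : SimpleGraph V) (p q r s : V)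
    (h1 : p ≠ q) (h2 : p ≠ r) (h3 : p ≠ s) (h4 : q ≠ r) (h5 : q ≠ s) (h6 : r ≠ s)
    (hpq : Gᶜ.Adj p q ∨ ∃ w, w ≠ p ∧ w ≠ q ∧ w ≠ r ∧ w ≠ s ∧ G.dist p w ≠ G.dist q w)
    (hpr : Gᶜ.Adj p r ∨ ∃ w, w ≠ p ∧ w ≠ q ∧ w ≠ r ∧ w ≠ s ∧ G.dist p w ≠ G.dist r w)
    (hps : Gᶜ.Adj p s ∨ ∃ w, w ≠ p ∧ w ≠ q ∧ w ≠ r ∧ w ≠ s ∧ G.dist p w ≠ G.dist s w)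
    (hqr : Gᶜ.Adj q r ∨ ∃ w, w ≠ p ∧ w ≠ q ∧ w ≠ r ∧ w ≠ s ∧ G.dist q w ≠ G.dist r w)
    (hqs : Gᶜ.Adj q s ∨ ∃ w, w ≠ p ∧ w ≠ q ∧ w ≠ r ∧ w ≠ s ∧ G.dist q w ≠ G.dist s w)
    (hrs : Gᶜ.Adj r s ∨ ∃ w, w ≠ p ∧ w ≠ q ∧ w ≠ r ∧ w ≠ s ∧ G.dist r w ≠ G.dist s w) :
    ∃ S : Finset V, S.card = 4 ∧ ComplResolves G S := by
  classical
  refine ⟨{p, q, r, s}, Finset.card_eq_four.2 ⟨p, q, r, s, h1, h2, h3, h4, h5, h6, rfl⟩, ?_⟩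
  intro u hu v hv huv
  simp only [Finset.mem_insert, Finset.mem_singleton, not_or] at hu hv ⊢
  simp only [SimpleGraph.compl_adj] at hpq hpr hps hqr hqs hrs
  have hs := G.adj_comm u v
  have hne := huv.ne
  rcases hu with rfl | rfl | rfl | rfl <;> rcases hv with rfl | rfl | rfl | rfl <;> grind

/-- `x` and `y` dominate the two sides of a spanning bipartite structure on the edges of `H`. -/
structure IsDominatingPair {V : Type*} (H : SimpleGraph V) (x y : V) : Prop where
  adj : H.Adj x y
  cover : ∀ p q, H.Adj p q → (H.Adj x p ∧ H.Adj y q) ∨ (H.Adj y p ∧ H.Adj x q)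

theorem IsDominatingPair.symm {V : Type*} {H : SimpleGraph V} {x y : V}
    (h : IsDominatingPair H x y) : IsDominatingPair H y x :=
  ⟨h.adj.symm, fun p q hpq => (h.cover p q hpq).symm⟩

/-- If a₂ missed b₂, then {x, b₁, b₂, y} would be spread, with a₁ and a₂ as the outside witnesses.
So a neighbour of a non-dominating vertex b₁ is itself dominating. -/
theorem IsDominatingPair.levels {V : Type*} {H : SimpleGraph V} {x y : V} (hbad : NoSpreadFour H)
    (htri : NoTriangle H) (h : IsDominatingPair H x y) {b₁ b₂ a₁ a₂ : V} (hb₁ : H.Adj y b₁)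
    (hb₂ : H.Adj y b₂) (ha₁ : H.Adj x a₁) (h₁ : ¬ H.Adj a₁ b₁) (h₂ : H.Adj a₂ b₁) :
    H.Adj a₂ b₂ := by
  by_contra h₃
  have hs : ∀ u v, H.Adj u v → H.Adj v u := fun u v h => h.symm
  have hxy := h.adj
  have hirr : ∀ u, ¬ H.Adj u u := fun u => H.irrefl
  have n1 := htri x y b₁ hxy hb₁
  have n2 := htri x y b₂ hxy hb₂
  have n3 := htri x y a₁ hxy
  have ha₂ : H.Adj x a₂ := by
    rcases h.cover a₂ b₁ h₂ with h | h
    · exact h.1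
    · exact absurd h.2 n1
  obtain ⟨S, hS, hsp⟩ := exists_spread_card_four H x b₁ b₂ y (by grind) (by grind) hxy.ne
    (by grind) hb₁.ne' hb₂.ne'
    (.inr ⟨a₁, by grind⟩) (.inr ⟨a₂, by grind⟩) (.inl hxy)
    (.inr ⟨a₂, by grind⟩) (.inl hb₁.symm) (.inl hb₂.symm)
  exact hbad S hS hsp

/-- If H has an isolated vertex z, the set {z, x, b, y} is spread. If not, {x, b, a, y} is resolved,
but only with the help of distances in G: a vertex c dominating one side is at distance at least 3
from x, whereas b reaches it through a. -/
theorem IsDominatingPair.eq_of_adj {V : Type*} {G : SimpleGraph V} (hconn : G.Connected)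
    (hres : ∀ S : Finset V, S.card = 4 → ¬ ComplResolves G S)
    (hcov : NoCoverTwo Gᶜ) (htri : NoTriangle Gᶜ) {x y : V}
    (h : IsDominatingPair Gᶜ x y) {a b c : V} (ha : Gᶜ.Adj x a) (hb : Gᶜ.Adj y b)
    (hab : ¬ Gᶜ.Adj a b) (hc : Gᶜ.Adj c b) : c = y := by
  by_contra hcy
  have hbad : NoSpreadFour Gᶜ := fun S hS hsp => hres S hS hsp.complResolves
  have hg : ∀ u v, u ≠ v → ¬ Gᶜ.Adj u v → G.Adj u v := by
    intro u v huv h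
    rw [SimpleGraph.compl_adj] at h
    tauto
  have hng : ∀ u v, Gᶜ.Adj u v → ¬ G.Adj u v := fun u v h => ((SimpleGraph.compl_adj _ _ _).1 h).2
  have hlev := fun {b₁ b₂ a₁ a₂ : V} => h.levels hbad htri (b₁ := b₁) (b₂ := b₂) (a₁ := a₁)
    (a₂ := a₂)
  have hxy := h.adj
  have hcover := h.cover
  generalize hH : Gᶜ = H at *
  have hs : ∀ u v, H.Adj u v → H.Adj v u := fun u v h => h.symm
  have hirr : ∀ u, ¬ H.Adj u u := fun u => H.irrefl
  have nxb := htri x y b hxy hb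
  have nya := htri y x a hxy.symm ha
  have hxc : H.Adj x c := by
    rcases hcover c b hc with h | h
    · exact h.1
    · exact absurd h.2 nxb
  have nyc := htri y x c hxy.symm hxc
  -- As {x, b} is not a cover, y has a third neighbour.
  obtain ⟨w, hyw, hwx, hwb⟩ : ∃ w, H.Adj y w ∧ w ≠ x ∧ w ≠ b := by
    obtain ⟨u, v, h1, h2, h3, h4, huv⟩ := hcov x b
    rcases hcover u v huv with h | h
    · exact ⟨v, h.2, h3, h4⟩
    · exact ⟨u, h.1, h1, h2⟩
  have nxw := htri x y w hxy hyw
  have nbw : ¬ H.Adj b w := htri b y w hb.symm hyw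
  have nac : ¬ H.Adj a c := htri a x c ha.symm hxc
  by_cases hZ : ∃ z, ¬ H.Adj x z ∧ ¬ H.Adj y z
  · obtain ⟨z, hxz, hyz⟩ := hZ
    have hz : ∀ u, ¬ H.Adj u z := by
      intro u hu
      rcases hcover u z hu with h | h
      · exact hyz h.2
      · exact hxz h.2
    obtain ⟨S, hS, hsp⟩ := exists_spread_card_four H z x b y (by grind) (by grind) (by grind)
      (by grind) hxy.ne hb.ne'
      (.inr ⟨a, by grind⟩) (.inr ⟨c, by grind⟩) (.inr ⟨w, by grind⟩)
      (.inr ⟨a, by grind⟩) (.inl hxy) (.inl hb.symm)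
    exact hbad S hS hsp
  · push Not at hZ
    have side : ∀ t, ¬ H.Adj x t → H.Adj y t := hZ
    have side' : ∀ t, ¬ H.Adj y t → H.Adj x t := fun t ht => by
      by_contra h; exact ht (hZ t h)
    have ac : a ≠ c := by rintro rfl; exact hab hc
    have bx : b ≠ x := by rintro rfl; exact hab ha.symm
    have ay : a ≠ y := by rintro rfl; exact hab hb
    have xc := hxc.ne
    have yw := hyw.ne
    have eab : a ≠ b := by rintro rfl; exact nya hb
    have cb := hc.ne
    have wa : w ≠ a := by rintro rfl; exact nya hyw
    have cfull : ∀ t, H.Adj y t → H.Adj c t := fun t ht => hlev hb ht ha hab hc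
    have gab := hg a b eab hab
    have d1 : G.dist x c ≠ G.dist b c := by
      have h3 : 3 ≤ G.dist x c := hconn.three_le_dist xc (hng _ _ hxc) (fun t h1 h2 =>
        hng _ _ (cfull t (side t fun h => hng _ _ h h1)) h2.symm)
      have h2 := SimpleGraph.dist_le_two gab.symm (hg a c ac nac)
      omega
    have d2 : G.dist b c ≠ G.dist a c := by
      have h1 := SimpleGraph.dist_eq_one_iff_adj.2 (hg a c ac nac)
      have h2 : G.dist b c ≠ 1 := fun h =>
        hng _ _ hc.symm (SimpleGraph.dist_eq_one_iff_adj.1 h)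
      omega
    -- If w is H-adjacent to a, it dominates N(x) and the distance argument repeats with y and w; if
    -- not, adjacency in G already separates a from y.
    have d3 : G.dist a w ≠ G.dist y w := by
      by_cases haw : H.Adj a w
      · have wfull : ∀ t, H.Adj x t → H.Adj t w := by
          intro t ht
          by_contra htw
          exact hab (hlev hyw hb ht htw haw)
        have h3 : 3 ≤ G.dist y w := hconn.three_le_dist yw (hng _ _ hyw) (fun t h1 h2 =>
          hng _ _ (wfull t (side' t fun h => hng _ _ h h1)) h2)
        have h2 := SimpleGraph.dist_le_two gab (hg b w hwb.symm nbw)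
        omega
      · have h1 := SimpleGraph.dist_eq_one_iff_adj.2 (hg a w wa.symm haw)
        have h2 : G.dist y w ≠ 1 := fun h => hng _ _ hyw (SimpleGraph.dist_eq_one_iff_adj.1 h)
        omega
    subst hH
    obtain ⟨S, hS, hsp⟩ := exists_complResolves_card_four G x b a y bx.symm ha.ne hxy.ne
      eab.symm hb.ne' ay
      (.inr ⟨c, xc.symm, cb, ac.symm, hcy, d1⟩) (.inl ha) (.inl hxy)
      (.inr ⟨c, xc.symm, cb, ac.symm, hcy, d2⟩) (.inl hb.symm)
      (.inr ⟨w, hwx, hwb, wa, yw.symm, d3⟩)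
    exact hres S hS hsp

/-- A missing pair ab would leave b with y as its only neighbour. An edge pq avoiding x and y then
has p not adjacent to b, and the mirrored statement leaves p with x as its only neighbour, against
pq. -/
theorem IsDominatingPair.adj_of_adj_of_adj {V : Type*} {G : SimpleGraph V} (hconn : G.Connected)
    (hres : ∀ S : Finset V, S.card = 4 → ¬ ComplResolves G S)
    (hcov : NoCoverTwo Gᶜ) (htri : NoTriangle Gᶜ) {x y : V}
    (h : IsDominatingPair Gᶜ x y) {a b : V} (ha : Gᶜ.Adj x a) (hb : Gᶜ.Adj y b) :
    Gᶜ.Adj a b := by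
  by_contra hab
  obtain ⟨p, q, hpx, hpy, hqx, hqy, hpq, hxp, hyq⟩ : ∃ p q, p ≠ x ∧ p ≠ y ∧ q ≠ x ∧ q ≠ y ∧
      Gᶜ.Adj p q ∧ Gᶜ.Adj x p ∧ Gᶜ.Adj y q := by
    obtain ⟨u, v, h1, h2, h3, h4, huv⟩ := hcov x y
    rcases h.cover u v huv with h | h
    · exact ⟨u, v, h1, h2, h3, h4, huv, h⟩
    · exact ⟨v, u, h3, h4, h1, h2, huv.symm, h.2, h.1⟩
  have hpb : ¬ Gᶜ.Adj p b := fun h' =>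
    hpy (h.eq_of_adj hconn hres hcov htri ha hb hab h')
  exact hqx (h.symm.eq_of_adj hconn hres hcov htri hb hxp (fun h' => hpb h'.symm) hpq.symm)

/-- The structure of connected graphs whose clique number is small and in which no four vertices
are resolved by the remaining ones. -/
theorem cycle_or_biclique_of_noCoverTwo {V : Type*} [Fintype V] {G : SimpleGraph V}
    (hconn : G.Connected)
    (hres : ∀ S : Finset V, S.card = 4 → ¬ ComplResolves G S) (hcov : NoCoverTwo Gᶜ) :
    Nonempty (G ≃g SimpleGraph.cycleGraph 5) ∨
      (∃ l m : ℕ, 2 ≤ m ∧ m ≤ l ∧ l + m < Fintype.card V ∧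
          Nonempty (G ≃g completeMinusBiclique (Fintype.card V) l m)) := by
  classical
  have hbad : NoSpreadFour Gᶜ := fun S hS hsp => hres S hS hsp.complResolves
  have htri := hbad.noTriangle hconn hcov
  have h2k := hbad.noTwoEdges htri hcov
  by_cases hpent : ∃ a b c d e, IsPentagon Gᶜ a b c d e
  · obtain ⟨a, b, c, d, e, h⟩ := hpent
    exact .inl (h.nonempty_iso_cycleGraph htri (h.eq_of_noSpreadFour hbad htri h2k))
  push Not at hpent
  right
  have := hconn.nonempty
  obtain ⟨x, hx⟩ := exists_neighborhood_cover h2k hpent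
  obtain ⟨u, v, -, -, -, -, huv⟩ := hcov x x
  obtain ⟨y, hxy, hcover⟩ := exists_dominating_pair htri h2k hx huv
  have hdom : IsDominatingPair Gᶜ x y := ⟨hxy, hcover⟩
  have hfull := fun {a b : V} (ha : Gᶜ.Adj x a) (hb : Gᶜ.Adj y b) =>
    hdom.adj_of_adj_of_adj hconn hres hcov htri ha hb
  have two : ∀ {x y : V}, IsDominatingPair Gᶜ x y →
      2 ≤ (Finset.univ.filter (Gᶜ.Adj x)).card := by
    intro x y h
    obtain ⟨u, v, h1, h2, h3, h4, huv⟩ := hcov x y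
    rcases h.cover u v huv with h' | h'
    · exact Finset.one_lt_card.2 ⟨u, by simpa using h'.1, y, by simpa using h.adj, h2⟩
    · exact Finset.one_lt_card.2 ⟨v, by simpa using h'.2, y, by simpa using h.adj, h4⟩
  -- If the two sides exhausted the vertices, G would have no edge between them and be disconnected.
  have hout : ∃ z, ¬ Gᶜ.Adj x z ∧ ¬ Gᶜ.Adj y z := by
    by_contra hcon
    push Not at hcon
    obtain ⟨p, q, hp, hq, hpq⟩ := hconn.exists_adj_mem_notMem {t | Gᶜ.Adj x t} (a := y) (b := x)
      hxy (fun h => Gᶜ.irrefl h)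
    exact ((SimpleGraph.compl_adj _ _ _).1 (hfull hp (hcon q hq))).2 hpq
  have main : ∀ {x y : V}, IsDominatingPair Gᶜ x y →
      (∀ {a b : V}, Gᶜ.Adj x a → Gᶜ.Adj y b → Gᶜ.Adj a b) →
      (∃ z, ¬ Gᶜ.Adj x z ∧ ¬ Gᶜ.Adj y z) →
      (Finset.univ.filter (Gᶜ.Adj y)).card ≤ (Finset.univ.filter (Gᶜ.Adj x)).card →
      ∃ l m : ℕ, 2 ≤ m ∧ m ≤ l ∧ l + m < Fintype.card V ∧
          Nonempty (G ≃g completeMinusBiclique (Fintype.card V) l m) := by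
    intro x y h hfull hout hle
    have hdisj : Disjoint (Finset.univ.filter (Gᶜ.Adj x)) (Finset.univ.filter (Gᶜ.Adj y)) := by
      rw [Finset.disjoint_left]
      intro t h1 h2
      exact htri x y t h.adj (by simpa using h2) (by simpa using h1)
    refine ⟨_, _, two h.symm, hle, ?_, nonempty_iso_completeMinusBiclique _ _ hdisj ?_⟩
    · rw [← Finset.card_union_of_disjoint hdisj]
      obtain ⟨z, h1, h2⟩ := hout
      refine Finset.card_lt_univ_of_notMem (x := z) ?_
      simp only [Finset.mem_union, Finset.mem_filter, Finset.mem_univ, true_and]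
      tauto
    · intro u v
      simp only [Finset.mem_filter, Finset.mem_univ, true_and]
      constructor
      · intro huv
        refine ⟨huv.ne, fun h' => ?_, fun h' => ?_⟩
        · exact ((SimpleGraph.compl_adj _ _ _).1 (hfull h'.1 h'.2)).2 huv
        · exact ((SimpleGraph.compl_adj _ _ _).1 (hfull h'.1 h'.2)).2 huv.symm
      · rintro ⟨hne, h1, h2⟩
        by_contra hadj
        rcases h.cover u v ((SimpleGraph.compl_adj _ _ _).2 ⟨hne, hadj⟩) with h' | h'
        · exact h1 h'
        · exact h2 ⟨h'.2, h'.1⟩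
  rcases le_total (Finset.univ.filter (Gᶜ.Adj y)).card (Finset.univ.filter (Gᶜ.Adj x)).card
    with hle | hle
  · exact main hdom hfull hout hle
  · obtain ⟨z, h1, h2⟩ := hout
    exact main hdom.symm (fun ha hb => (hfull hb ha).symm) ⟨z, h2, h1⟩ hle

/-! ### Existence of a good three-set -/

/-- If no three-set is spread, H has no triangle and no induced pair of edges, and every path on
four vertices closes up. Connectedness of G gives a vertex v isolated in H, and the cover hypothesis
gives both ends of an edge pu a second neighbour; so {p, u, v} is spread after all. -/
theorem exists_complResolves_card_three {V : Type*} {G : SimpleGraph V} (hconn : G.Connected)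
    (hcov : ∀ x : V, ∃ u v, u ≠ x ∧ v ≠ x ∧ Gᶜ.Adj u v) :
    ∃ S : Finset V, S.card = 3 ∧ ComplResolves G S := by
  by_contra hcon
  have hno : ¬ ∃ S : Finset V, S.card = 3 ∧ Spread Gᶜ S := fun ⟨S, hS, hsp⟩ =>
    hcon ⟨S, hS, hsp.complResolves⟩
  have hng : ∀ u v, Gᶜ.Adj u v → ¬ G.Adj u v := fun u v h => ((SimpleGraph.compl_adj _ _ _).1 h).2
  generalize Gᶜ = H at hno hcov hng
  have hs : ∀ u v, H.Adj u v → H.Adj v u := fun u v h => h.symm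
  have hirr : ∀ u, ¬ H.Adj u u := fun u => H.irrefl
  have htri : NoTriangle H := fun a b c hab hbc hac =>
    hno (exists_spread_card_three H a b c hab.ne hac.ne hbc.ne (.inl hab) (.inl hac) (.inl hbc))
  have h2k : NoTwoEdges H := by
    intro a b c d hab hcd hac had hbc hbd
    by_contra h
    push Not at h
    obtain ⟨n1, n2, n3, n4⟩ := h
    exact hno (exists_spread_card_three H a b c hab.ne hac hbc (.inl hab)
      (.inr ⟨d, by grind⟩) (.inr ⟨d, by grind⟩))
  have hclose : ∀ p q r s, H.Adj p q → H.Adj q r → H.Adj r s → H.Adj p s := by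
    intro p q r s hpq hqr hrs
    by_contra hps
    have n1 := htri p q r hpq hqr
    exact hno (exists_spread_card_three H p q r hpq.ne (by grind) hqr.ne (.inl hpq)
      (.inr ⟨s, by grind⟩) (.inl hqr))
  have other : ∀ p u, H.Adj p u → ∃ u', u' ≠ u ∧ H.Adj p u' := by
    intro p u hpu
    by_contra honly
    push Not at honly
    obtain ⟨e, f, heu, hfu, hef⟩ := hcov u
    have hpe : ¬ H.Adj p e := honly e heu
    have hpf : ¬ H.Adj p f := honly f hfu
    have pe : p ≠ e := by rintro rfl; exact hpf hef
    have pf : p ≠ f := by rintro rfl; exact hpe hef.symm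
    rcases h2k p u e f hpu hef pe pf heu.symm hfu.symm with h | h | h | h
    · exact hpe h
    · exact hpf h
    · exact hpf (hclose p u e f hpu h hef)
    · exact hpe (hclose p u f e hpu h hef.symm)
  have := hconn.nonempty
  obtain ⟨p, q, -, -, hpq⟩ := hcov (Classical.arbitrary V)
  obtain ⟨u, v, hpu, hpv, huv⟩ := hconn.exists_adj_mem_notMem {t | H.Adj p t} (a := q) (b := p)
    hpq (hirr p)
  change H.Adj p u at hpu
  change ¬ H.Adj p v at hpv
  have nuv : ¬ H.Adj u v := fun h => hng _ _ h huv
  have hvp : v ≠ p := by rintro rfl; exact nuv hpu.symm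
  have hiso : ∀ t, ¬ H.Adj v t := by
    intro t hvt
    have h1 : p ≠ t := by rintro rfl; exact hpv hvt.symm
    have h2 : u ≠ t := by rintro rfl; exact nuv hvt.symm
    rcases h2k p u v t hpu hvt hvp.symm h1 huv.ne h2 with h | h | h | h
    · exact hpv h
    · exact nuv (hclose v t p u hvt h.symm hpu).symm
    · exact nuv h
    · exact hpv (hclose v t u p hvt h.symm hpu.symm).symm
  obtain ⟨u', hu', hpu'⟩ := other p u hpu
  obtain ⟨p', hp', hup'⟩ := other u p hpu.symm
  have i1 := hiso u'
  have i2 := hiso p'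
  exact hno (exists_spread_card_three H p u v hpu.ne hvp.symm huv.ne (.inl hpu)
    (.inr ⟨u', by grind⟩) (.inr ⟨p', by grind⟩))

/-! ### Large cliques -/

/-- Two vertices of a clique can only be resolved by a vertex outside the clique. -/
theorem ComplResolves.exists_notMem_clique {V : Type*} {G : SimpleGraph V} {S K : Finset V}
    (hS : ComplResolves G S) (hK : G.IsClique (K : Set V)) {u v : V} (hu : u ∈ S) (hv : v ∈ S)
    (huK : u ∈ K) (hvK : v ∈ K) (huv : u ≠ v) :
    ∃ w, w ∉ S ∧ w ∉ K ∧ G.dist u w ≠ G.dist v w := by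
  obtain ⟨w, hw, hd⟩ := hS u hu v hv (hK huK hvK huv)
  refine ⟨w, hw, fun hwK => hd ?_, hd⟩
  rw [SimpleGraph.dist_eq_one_iff_adj.2 (hK huK hwK (fun h => hw (h ▸ hu))),
    SimpleGraph.dist_eq_one_iff_adj.2 (hK hvK hwK (fun h => hw (h ▸ hv)))]

/-- Distances from a fixed vertex take at most two values on a clique. -/
theorem SimpleGraph.Connected.dist_eq_of_clique {V : Type*} {G : SimpleGraph V}
    (hG : G.Connected) {a b c : V} (hab : G.Adj a b) (hac : G.Adj a c) (hbc : G.Adj b c) (w : V) :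
    G.dist a w = G.dist b w ∨ G.dist a w = G.dist c w ∨ G.dist b w = G.dist c w := by
  have e : ∀ u v, G.Adj u v → G.dist u w ≤ 1 + G.dist v w := by
    intro u v h
    have := hG.dist_triangle (u := u) (v := v) (w := w)
    rwa [SimpleGraph.dist_eq_one_iff_adj.2 h] at this
  have h1 := e a b hab
  have h2 := e b a hab.symm
  have h3 := e a c hac
  have h4 := e c a hac.symm
  have h5 := e b c hbc
  have h6 := e c b hbc.symm
  omega

theorem not_complResolves_of_clique_of_three {V : Type*} {G : SimpleGraph V} (hG : G.Connected)
    {S K : Finset V} (hK : G.IsClique (K : Set V)) {x : V} (hx : ∀ w, w ∉ S → w ∉ K → w = x)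
    {a b c : V} (ha : a ∈ S) (hb : b ∈ S) (hc : c ∈ S) (haK : a ∈ K) (hbK : b ∈ K) (hcK : c ∈ K)
    (hab : a ≠ b) (hac : a ≠ c) (hbc : b ≠ c) : ¬ ComplResolves G S := by
  intro hS
  obtain ⟨w₁, h1, h1', d1⟩ := hS.exists_notMem_clique hK ha hb haK hbK hab
  obtain ⟨w₂, h2, h2', d2⟩ := hS.exists_notMem_clique hK ha hc haK hcK hac
  obtain ⟨w₃, h3, h3', d3⟩ := hS.exists_notMem_clique hK hb hc hbK hcK hbc
  rw [hx _ h1 h1'] at d1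
  rw [hx _ h2 h2'] at d2
  rw [hx _ h3 h3'] at d3
  rcases hG.dist_eq_of_clique (hK haK hbK hab) (hK haK hcK hac) (hK hbK hcK hbc) x with h | h | h
  · exact d1 h
  · exact d2 h
  · exact d3 h

theorem not_complResolves_of_card_le_cliqueNum {V : Type*} [Fintype V] {G : SimpleGraph V}
    (hG : G.Connected) (hω : Fintype.card V ≤ G.cliqueNum + 1) {S : Finset V} (hS : S.card = 3) :
    ¬ ComplResolves G S := by
  classical
  obtain ⟨K, hK⟩ := G.exists_isNClique_cliqueNum
  have hKc : Kᶜ.card ≤ 1 := by rw [Finset.card_compl, hK.card_eq]; omega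
  rw [Finset.card_le_one] at hKc
  have huniq : ∀ w w', w ∉ K → w' ∉ K → w = w' := fun w w' h h' =>
    hKc w (by simpa using h) w' (by simpa using h')
  by_cases hSK : S ⊆ K
  · obtain ⟨a, b, c, hab, hac, hbc, rfl⟩ := Finset.card_eq_three.1 hS
    have haK : a ∈ K := hSK (by simp)
    have hbK : b ∈ K := hSK (by simp)
    have hcK : c ∈ K := hSK (by simp)
    by_cases hx : ∃ x, x ∉ K
    · obtain ⟨x, hx⟩ := hx
      exact not_complResolves_of_clique_of_three hG hK.isClique (x := x)
        (fun w _ hw => huniq w x hw hx) (by simp) (by simp) (by simp) haK hbK hcK hab hac hbc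
    · push Not at hx
      exact not_complResolves_of_clique_of_three hG hK.isClique (x := a)
        (fun w _ hw => absurd (hx w) hw) (by simp) (by simp) (by simp) haK hbK hcK hab hac hbc
  · intro hr
    obtain ⟨x, hxS, hxK⟩ := Finset.not_subset.1 hSK
    have h2 : 1 < (S.erase x).card := by rw [Finset.card_erase_of_mem hxS]; omega
    obtain ⟨a, ha, b, hb, hab⟩ := Finset.one_lt_card.1 h2
    rw [Finset.mem_erase] at ha hb
    obtain ⟨w, hw, hwK, -⟩ := hr.exists_notMem_clique hK.isClique ha.2 hb.2
      (by by_contra h; exact ha.1 (huniq _ _ h hxK))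
      (by by_contra h; exact hb.1 (huniq _ _ h hxK)) hab
    exact hw (huniq x w hxK hwK ▸ hxS)

/-! ### Γ₁, Γ₂ and clique number n - 2 -/

theorem gamma1_adj (i j : Fin 6) : Gamma1.Adj i j ↔
    (![![false, true, true, true, true, true], ![true, false, true, true, true, false],
      ![true, true, false, true, false, true], ![true, true, true, false, false, false],
      ![true, true, false, false, false, false], ![true, false, true, false, false, false]] :
      Fin 6 → Fin 6 → Bool) i j = true := by
  simp only [Gamma1, SimpleGraph.fromEdgeSet_adj, Set.mem_insert_iff, Set.mem_singleton_iff]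
  revert i j
  decide

theorem gamma2_adj (i j : Fin 6) : Gamma2.Adj i j ↔
    (![![false, true, true, true, true, true], ![true, false, true, true, true, false],
      ![true, true, false, true, false, true], ![true, true, true, false, false, false],
      ![true, true, false, false, false, true], ![true, false, true, false, true, false]] :
      Fin 6 → Fin 6 → Bool) i j = true := by
  simp only [Gamma2, SimpleGraph.sup_adj, gamma1_adj, SimpleGraph.edge_adj]
  revert i j
  decide

/-- The clique vertices p, q, r, s have traces {x, y}, {x}, {y}, ∅ on {x, y}; whether xy is an edge
selects Γ₂ or Γ₁. The distinctness not listed follows from the adjacencies. -/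
theorem gamma_isIndContained {V : Type*} {G : SimpleGraph V} {p q r s x y : V}
    (hpq : G.Adj p q) (hpr : G.Adj p r) (hps : G.Adj p s) (hqr : G.Adj q r) (hqs : G.Adj q s)
    (hrs : G.Adj r s) (hxp : G.Adj x p) (hxq : G.Adj x q) (hxr : ¬ G.Adj x r) (hxs : ¬ G.Adj x s)
    (hyp : G.Adj y p) (hyq : ¬ G.Adj y q) (hyr : G.Adj y r) (hys : ¬ G.Adj y s)
    (hx : x ≠ r ∧ x ≠ s) (hy : y ≠ q ∧ y ≠ s) :
    Gamma1.IsIndContained G ∨ Gamma2.IsIndContained G := by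
  have hs : ∀ u v, G.Adj u v → G.Adj v u := fun u v h => h.symm
  have hirr : ∀ u, ¬ G.Adj u u := fun u => G.irrefl
  let f : Fin 6 → V := ![p, q, r, s, x, y]
  have hinj : Function.Injective f := by
    intro i j hij
    fin_cases i <;> fin_cases j <;> simp [f] at hij ⊢ <;> grind
  by_cases hxy : G.Adj x y
  · right
    refine ⟨⟨⟨f, hinj⟩, ?_⟩⟩
    intro i j
    rw [gamma2_adj]
    fin_cases i <;> fin_cases j <;> simp [f] <;> grind
  · left
    refine ⟨⟨⟨f, hinj⟩, ?_⟩⟩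
    intro i j
    rw [gamma1_adj]
    fin_cases i <;> fin_cases j <;> simp [f] <;> grind

theorem exists_complResolves_of_gamma {V : Type*} {G : SimpleGraph V} {p q r s x y : V}
    (hd : [p, q, r, s, x, y].Nodup)
    (hxp : G.Adj x p) (hxq : G.Adj x q) (hxr : ¬ G.Adj x r) (hxs : ¬ G.Adj x s)
    (hyp : G.Adj y p) (hyq : ¬ G.Adj y q) (hyr : G.Adj y r) (hys : ¬ G.Adj y s) :
    ∃ S : Finset V, S.card = 4 ∧ ComplResolves G S := by
  simp only [List.nodup_cons, List.mem_cons, List.not_mem_nil, or_false, not_or] at hd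
  obtain ⟨S, hS, hsp⟩ := exists_spread_card_four Gᶜ p q r s (by grind) (by grind) (by grind)
    (by grind) (by grind) (by grind)
    (.inr ⟨y, by simp only [SimpleGraph.compl_adj]; grind⟩)
    (.inr ⟨x, by simp only [SimpleGraph.compl_adj]; grind⟩)
    (.inr ⟨x, by simp only [SimpleGraph.compl_adj]; grind⟩)
    (.inr ⟨x, by simp only [SimpleGraph.compl_adj]; grind⟩)
    (.inr ⟨x, by simp only [SimpleGraph.compl_adj]; grind⟩)
    (.inr ⟨y, by simp only [SimpleGraph.compl_adj]; grind⟩)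
  exact ⟨S, hS, hsp.complResolves⟩

theorem exists_complResolves_of_isIndContained {V : Type*} {G : SimpleGraph V}
    (h : Gamma1.IsIndContained G ∨ Gamma2.IsIndContained G) :
    ∃ S : Finset V, S.card = 4 ∧ ComplResolves G S := by
  rcases h with ⟨⟨f⟩⟩ | ⟨⟨f⟩⟩
  all_goals
    refine exists_complResolves_of_gamma (p := f 0) (q := f 1) (r := f 2) (s := f 3) (x := f 4)
      (y := f 5) (by simp [f.injective.eq_iff]) ?_ ?_ ?_ ?_ ?_ ?_ ?_ ?_ <;>
    rw [f.map_adj_iff] <;> simp [gamma1_adj, gamma2_adj]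

theorem isIndContained_of_complResolves {V : Type*} [Fintype V] {G : SimpleGraph V}
    (hG : G.Connected) (hω : G.cliqueNum + 2 = Fintype.card V) {S : Finset V} (hS : S.card = 4)
    (hr : ComplResolves G S) : Gamma1.IsIndContained G ∨ Gamma2.IsIndContained G := by
  classical
  obtain ⟨K, hK⟩ := G.exists_isNClique_cliqueNum
  have hKc : Kᶜ.card = 2 := by rw [Finset.card_compl, hK.card_eq]; omega
  obtain ⟨x, y, hxy, hKc⟩ := Finset.card_eq_two.1 hKc
  have hout : ∀ w, w ∉ K ↔ w = x ∨ w = y := by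
    intro w
    rw [← Finset.mem_compl, hKc]; simp
  have hin : ∀ w, w ≠ x → w ≠ y → w ∈ K := by
    intro w h1 h2
    by_contra h
    exact ((hout w).1 h).elim h1 h2
  -- With exactly one of x, y in S, three clique vertices of S would have to be resolved by the
  -- other one alone.
  have one : ∀ x y, (∀ w, w ∉ K ↔ w = x ∨ w = y) → x ∈ S → y ∉ S → False := by
    intro x y hout hxS hyS
    have h3 : (S.erase x).card = 3 := by rw [Finset.card_erase_of_mem hxS]; omega
    obtain ⟨a, b, c, hab, hac, hbc, he⟩ := Finset.card_eq_three.1 h3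
    have mem : ∀ t, t ∈ ({a, b, c} : Finset V) → t ∈ S ∧ t ∈ K := by
      intro t ht
      rw [← he, Finset.mem_erase] at ht
      refine ⟨ht.2, ?_⟩
      by_contra h
      rcases (hout t).1 h with h | h
      · exact ht.1 h
      · exact hyS (h ▸ ht.2)
    have ma := mem a (by simp)
    have mb := mem b (by simp)
    have mc := mem c (by simp)
    refine not_complResolves_of_clique_of_three hG hK.isClique (x := y) (fun w hw hwK => ?_)
      ma.1 mb.1 mc.1 ma.2 mb.2 mc.2 hab hac hbc hr
    rcases (hout w).1 hwK with h | h
    · exact absurd hxS (h ▸ hw)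
    · exact h
  by_cases hxS : x ∈ S
  · by_cases hyS : y ∈ S
    · have h2 : 1 < ((S.erase x).erase y).card := by
        rw [Finset.card_erase_of_mem (Finset.mem_erase.2 ⟨hxy.symm, hyS⟩),
          Finset.card_erase_of_mem hxS]
        omega
      obtain ⟨a, ha, b, hb, hab⟩ := Finset.one_lt_card.1 h2
      simp only [Finset.mem_erase] at ha hb
      obtain ⟨w, hw, hwK, -⟩ := hr.exists_notMem_clique hK.isClique ha.2.2 hb.2.2
        (hin a ha.2.1 ha.1) (hin b hb.2.1 hb.1) hab
      rcases (hout w).1 hwK with h | h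
      · exact absurd hxS (h ▸ hw)
      · exact absurd hyS (h ▸ hw)
    · exact (one x y hout hxS hyS).elim
  · by_cases hyS : y ∈ S
    · exact (one y x (fun w => (hout w).trans or_comm) hyS hxS).elim
    · have hSx : ∀ t ∈ S, t ≠ x := fun t ht h => hxS (h ▸ ht)
      have hSy : ∀ t ∈ S, t ≠ y := fun t ht h => hyS (h ▸ ht)
      have hSK : ∀ t ∈ S, t ∈ K := fun t ht => hin t (hSx t ht) (hSy t ht)
      -- Equal traces would make two members of S adjacent twins, so four vertices realise all four
      -- traces.
      let φ : S → Bool × Bool := fun t => (decide (G.Adj x t), decide (G.Adj y t))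
      have hφ : Function.Injective φ := by
        rintro ⟨u, hu⟩ ⟨v, hv⟩ huv
        simp only [φ, Prod.mk.injEq, decide_eq_decide] at huv
        by_contra hne
        have hne' : u ≠ v := fun h => hne (Subtype.ext h)
        refine not_complResolves_of_twins hG hu hv (hK.isClique (hSK u hu) (hSK v hv) hne') ?_ hr
        intro w hwu hwv
        by_cases hwK : w ∈ K
        · exact iff_of_true (hK.isClique (hSK u hu) hwK hwu.symm)
            (hK.isClique (hSK v hv) hwK hwv.symm)
        · rcases (hout w).1 hwK with rfl | rfl
          · rw [G.adj_comm u, G.adj_comm v]; exact huv.1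
          · rw [G.adj_comm u, G.adj_comm v]; exact huv.2
      have hsurj : Function.Surjective φ :=
        ((Fintype.bijective_iff_injective_and_card φ).2 ⟨hφ, by simp [hS]⟩).2
      obtain ⟨⟨p, hp⟩, ep⟩ := hsurj (true, true)
      obtain ⟨⟨q, hq⟩, eq⟩ := hsurj (true, false)
      obtain ⟨⟨r, hr'⟩, er⟩ := hsurj (false, true)
      obtain ⟨⟨s, hs⟩, es⟩ := hsurj (false, false)
      simp only [φ, Prod.mk.injEq, decide_eq_true_eq, decide_eq_false_iff_not] at ep eq er es
      have adj : ∀ u ∈ S, ∀ v ∈ S, u ≠ v → G.Adj u v := fun u hu v hv h =>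
        hK.isClique (hSK u hu) (hSK v hv) h
      exact gamma_isIndContained (p := p) (q := q) (r := r) (s := s) (x := x) (y := y)
        (adj p hp q hq (by grind)) (adj p hp r hr' (by grind)) (adj p hp s hs (by grind))
        (adj q hq r hr' (by grind)) (adj q hq s hs (by grind)) (adj r hr' s hs (by grind))
        ep.1 eq.1 er.1 es.1 ep.2 eq.2 er.2 es.2
        ⟨(hSx r hr').symm, (hSx s hs).symm⟩ ⟨(hSy q hq).symm, (hSy s hs).symm⟩

/-! ### The families C₅ and K_n⁻(λ, μ) -/

theorem compl_adj_of_iso_cycleGraph {V : Type*} {G : SimpleGraph V}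
    (e : G ≃g SimpleGraph.cycleGraph 5) (x : V) : ∃ u v, u ≠ x ∧ v ≠ x ∧ Gᶜ.Adj u v := by
  have h : ∀ i : Fin 5, i + 1 ≠ i ∧ i + 3 ≠ i ∧ i + 1 ≠ i + 3 ∧
      ¬ (SimpleGraph.cycleGraph 5).Adj (i + 1) (i + 3) := by decide
  obtain ⟨h1, h2, h3, h4⟩ := h (e x)
  refine ⟨e.symm (e x + 1), e.symm (e x + 3), ?_, ?_, ?_⟩
  · intro h; exact h1 (by simpa using congrArg e h)
  · intro h; exact h2 (by simpa using congrArg e h)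
  · rw [SimpleGraph.compl_adj, e.symm.map_adj_iff]
    exact ⟨fun h => h3 (e.symm.injective h), h4⟩

/-- The edge opposite to the single outside vertex has both ends at distance 2 from it. -/
theorem not_complResolves_of_iso_cycleGraph {V : Type*} [Fintype V] {G : SimpleGraph V}
    (hG : G.Connected) (e : G ≃g SimpleGraph.cycleGraph 5) {S : Finset V} (hS : S.card = 4) :
    ¬ ComplResolves G S := by
  classical
  intro hr
  have hV : Fintype.card V = 5 := by simpa using Fintype.card_congr e.toEquiv
  have h1 : Sᶜ.card = 1 := by rw [Finset.card_compl]; omega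
  obtain ⟨x, hx⟩ := Finset.card_eq_one.1 h1
  have hmem : ∀ t, t ∉ S ↔ t = x := by
    intro t
    rw [← Finset.mem_compl, hx, Finset.mem_singleton]
  have hin : ∀ t, t ≠ x → t ∈ S := fun t ht => by
    by_contra h; exact ht ((hmem t).1 h)
  have hc : ∀ i : Fin 5, i + 2 ≠ i ∧ i + 3 ≠ i ∧
      (SimpleGraph.cycleGraph 5).Adj (i + 2) (i + 3) ∧
      ¬ (SimpleGraph.cycleGraph 5).Adj (i + 2) i ∧ ¬ (SimpleGraph.cycleGraph 5).Adj (i + 3) i ∧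
      (SimpleGraph.cycleGraph 5).Adj (i + 2) (i + 1) ∧
      (SimpleGraph.cycleGraph 5).Adj (i + 1) i ∧ (SimpleGraph.cycleGraph 5).Adj (i + 3) (i + 4) ∧
      (SimpleGraph.cycleGraph 5).Adj (i + 4) i := by decide
  obtain ⟨i, rfl⟩ := e.symm.surjective x
  obtain ⟨c1, c2, c3, c4, c5, c6, c7, c8, c9⟩ := hc i
  have two : ∀ j k, j ≠ i → ¬ (SimpleGraph.cycleGraph 5).Adj j i →
      (SimpleGraph.cycleGraph 5).Adj j k → (SimpleGraph.cycleGraph 5).Adj k i →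
      G.dist (e.symm j) (e.symm i) = 2 := by
    intro j k hji hn hjk hki
    have h1 := SimpleGraph.dist_le_two (e.symm.map_adj_iff.2 hjk) (e.symm.map_adj_iff.2 hki)
    have h2 : G.dist (e.symm j) (e.symm i) ≠ 1 := fun h =>
      hn (e.symm.map_adj_iff.1 (SimpleGraph.dist_eq_one_iff_adj.1 h))
    have h3 := hG.pos_dist_of_ne (fun h => hji (e.symm.injective h) : e.symm j ≠ e.symm i)
    omega
  obtain ⟨w, hw, hd⟩ := hr (e.symm (i + 2)) (hin _ fun h => c1 (e.symm.injective h))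
    (e.symm (i + 3)) (hin _ fun h => c2 (e.symm.injective h)) (e.symm.map_adj_iff.2 c3)
  rw [(hmem w).1 hw, two _ _ c1 c4 c6 c7, two _ _ c2 c5 c8 c9] at hd
  exact hd rfl

/-- The removed edges {0, l} and {1, l + 1} are disjoint, so x misses one of them; this is where
both parts need size two. -/
theorem compl_adj_of_iso_completeMinusBiclique {V : Type*} {G : SimpleGraph V} {n l m : ℕ}
    (hm : 2 ≤ m) (hl : 2 ≤ l) (hn : l + m < n) (e : G ≃g completeMinusBiclique n l m) (x : V) :
    ∃ u v, u ≠ x ∧ v ≠ x ∧ Gᶜ.Adj u v := by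
  have key : ∀ i : ℕ, i < 2 → ∀ (h1 : i < n) (h2 : l + i < n),
      Gᶜ.Adj (e.symm ⟨i, h1⟩) (e.symm ⟨l + i, h2⟩) := by
    intro i hi h1 h2
    rw [SimpleGraph.compl_adj, e.symm.map_adj_iff]
    constructor
    · intro h
      have := congrArg Fin.val (e.symm.injective h)
      simp only at this
      omega
    · rintro ⟨-, h, -⟩
      exact h ⟨by simp only; omega, by simp only; omega, by simp only; omega⟩
  have hne : ∀ i, e x ≠ i → e.symm i ≠ x := by
    rintro i h rfl
    exact h (by simp)
  by_cases hx : (e x).val = 0 ∨ (e x).val = l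
  · refine ⟨_, _, hne _ ?_, hne _ ?_, key 1 (by omega) (by omega) (by omega)⟩ <;>
    · rw [Ne, Fin.ext_iff]; simp only; omega
  · refine ⟨_, _, hne _ ?_, hne _ ?_, key 0 (by omega) (by omega) (by omega)⟩ <;>
    · rw [Ne, Fin.ext_iff]; simp only; omega

/-- Among four vertices two share one of the three classes, and these are adjacent twins. -/
theorem not_complResolves_of_iso_completeMinusBiclique {V : Type*} {G : SimpleGraph V}
    (hG : G.Connected) {n l m : ℕ} (e : G ≃g completeMinusBiclique n l m) {S : Finset V}
    (hS : S.card = 4) : ¬ ComplResolves G S := by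
  classical
  let f : V → Fin 3 := fun v =>
    if (e v).val < l then 0 else if (e v).val < l + m then 1 else 2
  obtain ⟨u, hu, v, hv, huv, hf⟩ := Finset.exists_ne_map_eq_of_card_lt_of_maps_to
    (s := S) (t := Finset.univ) (f := f) (by simp [hS]) (fun _ _ => Finset.mem_coe.2 (Finset.mem_univ _))
  have hcl : ((e u).val < l ↔ (e v).val < l) ∧ ((e u).val < l + m ↔ (e v).val < l + m) := by
    simp only [f] at hf
    split_ifs at hf <;> omega
  have hadj : ∀ a b, G.Adj a b ↔ a ≠ b ∧
      ¬ ((e a).val < l ∧ l ≤ (e b).val ∧ (e b).val < l + m) ∧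
      ¬ ((e b).val < l ∧ l ≤ (e a).val ∧ (e a).val < l + m) := by
    intro a b
    rw [← e.map_adj_iff, ← e.injective.ne_iff (x := a) (y := b)]
    rfl
  refine not_complResolves_of_twins hG hu hv ?_ ?_
  · rw [hadj]
    exact ⟨huv, by omega, by omega⟩
  · intro w hwu hwv
    rw [hadj, hadj]
    have h1 := hwu.symm
    have h2 := hwv.symm
    simp only [ne_eq, h1, h2, not_false_eq_true, true_and]
    omega

/-! ### The characterisation -/

theorem theorem2p4 {V : Type*} [Fintype V] (G : SimpleGraph V) (hG : G.Connected)
    (hn : 5 ≤ Fintype.card V) :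
    localMetricDim G = Fintype.card V - 3 ↔
      (G.cliqueNum = Fintype.card V - 2 ∧
          ¬ Gamma1.IsIndContained G ∧ ¬ Gamma2.IsIndContained G) ∨
      Nonempty (G ≃g SimpleGraph.cycleGraph 5) ∨
      (∃ l m : ℕ, 2 ≤ m ∧ m ≤ l ∧ l + m < Fintype.card V ∧
          Nonempty (G ≃g completeMinusBiclique (Fintype.card V) l m)) := by
  classical
  rw [localMetricDim_eq_card_sub_three_iff G (by omega)]
  constructor
  · rintro ⟨⟨S, hS, hr⟩, hres⟩
    have hω : G.cliqueNum + 2 ≤ Fintype.card V := by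
      by_contra h
      exact not_complResolves_of_card_le_cliqueNum hG (by omega) hS hr
    rcases hω.eq_or_lt with h | h
    · left
      have hΓ : ¬ (Gamma1.IsIndContained G ∨ Gamma2.IsIndContained G) := fun hΓ => by
        obtain ⟨T, hT, hr'⟩ := exists_complResolves_of_isIndContained hΓ
        exact hres T hT hr'
      exact ⟨by omega, not_or.1 hΓ⟩
    · right
      refine cycle_or_biclique_of_noCoverTwo hG hres fun x y => ?_
      obtain ⟨u, v, hu, hv, huv⟩ := exists_compl_adj_of_cliqueNum G {x, y}
        (by have := Finset.card_le_two (a := x) (b := y); omega)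
      simp only [Finset.mem_insert, Finset.mem_singleton, not_or] at hu hv
      exact ⟨u, v, hu.1, hu.2, hv.1, hv.2, huv⟩
  · rintro (⟨hω, h1, h2⟩ | ⟨⟨e⟩⟩ | ⟨l, m, hm, hml, hlt, ⟨e⟩⟩)
    · refine ⟨exists_complResolves_card_three hG fun x => ?_, fun S hS hr => ?_⟩
      · obtain ⟨u, v, hu, hv, huv⟩ := exists_compl_adj_of_cliqueNum G {x}
          (by rw [Finset.card_singleton]; omega)
        exact ⟨u, v, by simpa using hu, by simpa using hv, huv⟩
      · exact (isIndContained_of_complResolves hG (by omega) hS hr).elim h1 h2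
    · exact ⟨exists_complResolves_card_three hG (compl_adj_of_iso_cycleGraph e),
        fun S hS => not_complResolves_of_iso_cycleGraph hG e hS⟩
    · exact ⟨exists_complResolves_card_three hG
          (compl_adj_of_iso_completeMinusBiclique hm (by omega) hlt e),
        fun S hS => not_complResolves_of_iso_completeMinusBiclique hG e hS⟩
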